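/- **Setting.** Let $T>0$ and let $\alpha:[0,T]\to(0,1)$ be Lipschitz continuous. Let $d\ge 1$, and let $\mathcal T_h$ be a finite mesh of non-overlapping elements $K\subset\mathbb R^d$, either all simplices or all affine tensor-product elements (affine images of the unit cube), which tessellates a domain $\overline\Omega_h=\bigcup_{K}K$ that is a cell of periodicity: for a lattice spanned by $d$ linearly independent periods, the translates of the elements by lattice vectors do not overlap and cover $\mathbb R^d$. (A box with periodic boundary conditions is the typical case.) Let $\mathcal P^s(K)$ be the polynomials of total degree at most $s$ if $K$ is a simplex and, if $K$ is a tensor-product element, the images under the affine map of the polynomials of degree at most $s$ in each variable on the unit cube. For integers $q_u,q_v\ge 0$ put $U_h^{q_u}=\{w:\ w|_K\in\mathcal P^{q_u}(K)\ \forall K\}$ and $V_h^{q_v}=\{w:\ w|_K\in\mathcal P^{q_v}(K)\ \forall K\}$. Let $\nabla_h$ be the elementwise gradient and $\|\cdot\|$ the norm of $L^2(\Omega_h)$. On every interelement face $F$ (periodic boundary faces being identified) the two adjacent elements are labelled $K^+$, $K^-$ in an arbitrary way, $\mathbf n^\pm$ are their outward unit normals, $w^\pm$ the traces from $K^\pm$,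 and $[v]=v^-\mathbf n^-+v^+\mathbf n^+$, $[\nabla u]=\nabla u^-\cdot\mathbf n^-+\nabla u^+\cdot\mathbf n^+$. For constants $\theta\in\mathbb R$, $\gamma,\zeta\ge0$ the numerical fluxes of a pair $(u,v)$ are $$v^*=\theta v^++(1-\theta)v^--\zeta[\nabla u],\qquad (\nabla u)^*=(1-\theta)\nabla u^++\theta\nabla u^--\gamma[v].$$ **Time discretization.** Let $M\ge1$, $\tau=T/M$, $t_m=m\tau$, $t_{1/2}=\tau/2$. For $1\le m\le M-1$ let $\sigma_m\in(\tfrac12,1)$ be the root of $\sigma-\bigl(1-\tfrac12\alpha(t_m+\sigma\tau)\bigr)=0$, and put $t_{m+\sigma_m}=t_m+\sigma_m\tau$ and, writing $\sigma=\sigma_m$, $a=\alpha(t_{m+\sigma_m})$, $$c_0^{(m)}=\frac{(1+\sigma)^{2-a}-\sigma^{2-a}}{2-a}-\frac{(1+\sigma)^{1-a}-\sigma^{1-a}}2,$$ $$c_i^{(m)}=\frac{(i+\sigma+1)^{2-a}-2(i+\sigma)^{2-a}+(i+\sigma-1)^{2-a}}{2-a}-\frac{(i+\sigma+1)^{1-a}-2(i+\sigma)^{1-a}+(i+\sigma-1)^{1-a}}2\quad(1\le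 i\le m-1),$$ $$c_m^{(m)}=\frac{3(m+\sigma)^{1-a}-(m+\sigma-1)^{1-a}}2-\frac{(m+\sigma)^{2-a}-(m+\sigma-1)^{2-a}}{2-a},$$ $a_i^{(m)}=c_i^{(m)}/\bigl(\tau^{a}\,\Gamma(2-a)\bigr)$. Let also $s_0=2^{1-b}\tau^{b}\,\Gamma(2-b)$ with $b=\alpha(t_{1/2})$. For a sequence $w^0,\dots,w^M$ put $w^{1/2}=\frac12(w^0+w^1)$ and, for $1\le m\le M-1$, $w^{m+\sigma_m}=\sigma_mw^{m+1}+(1-\sigma_m)w^m$ and $$\delta_tw^{m+\sigma_m}=\frac{(2\sigma_m+1)w^{m+1}-4\sigma_mw^m+(2\sigma_m-1)w^{m-1}}{2\tau}.$$ **Scheme.** Let $f$ be a source term with $f(\cdot,t)\in L^2(\Omega_h)$ for $0<t\le T$. A fully discrete solution consists of $(u_h^m,v_h^m)\in U_h^{q_u}\times V_h^{q_v}$, $0\le m\le M$, such that for all $\phi\in U_h^{q_u}$, $\psi\in V_h^{q_v}$ and all elements $K$ $$\int_K\nabla\phi\cdot\nabla\Bigl(\frac{u_h^1-u_h^0}\tau-v_h^{1/2}\Bigr)d\mathbf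 x=\int_{\partial K}\nabla\phi\cdot\mathbf n\,\bigl((v_h^{1/2})^*-v_h^{1/2}\bigr)dS,$$ $$\int_K\psi\frac{v_h^1-v_h^0}\tau+\nabla\psi\cdot\nabla u_h^{1/2}+\psi\frac{v_h^1-v_h^0}{s_0}\,d\mathbf x=\int_K\psi f(\cdot,t_{1/2})\,d\mathbf x+\int_{\partial K}\psi\,(\nabla u_h^{1/2})^*\cdot\mathbf n\,dS,$$ and, for $1\le m\le M-1$, $$\int_K\nabla\phi\cdot\nabla\bigl(\delta_tu_h^{m+\sigma_m}-v_h^{m+\sigma_m}\bigr)d\mathbf x=\int_{\partial K}\nabla\phi\cdot\mathbf n\,\bigl((v_h^{m+\sigma_m})^*-v_h^{m+\sigma_m}\bigr)dS,$$ $$\int_K\psi\,\delta_tv_h^{m+\sigma_m}+\nabla\psi\cdot\nabla u_h^{m+\sigma_m}+\psi\sum_{i=0}^ma_{m-i}^{(m)}(v_h^{i+1}-v_h^i)\,d\mathbf x=\int_K\psi f(\cdot,t_{m+\sigma_m})\,d\mathbf x+\int_{\partial K}\psi\,(\nabla u_h^{m+\sigma_m})^*\cdot\mathbf n\,dS.$$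 (Further equations that fix the mean value of $u_h^m$ on each element may be added; they are not needed.) **Theorem (energy stability).** There are constants $\tau_0>0$ and $C>0$, depending only on $T$ and $\alpha$ (in particular independent of $\tau$, of the mesh and its size $h$, of $m$, $d$, $\theta$, $\gamma$, $\zeta$, $f$ and of the polynomial degrees $q_u,q_v$, which are arbitrary), such that, whenever $\tau\le\tau_0$, every fully discrete solution satisfies for all $0\le m\le M$ $$\|\nabla_hu_h^m\|^2+\|v_h^m\|^2\le C\Bigl(\|\nabla_hu_h^0\|^2+\|v_h^0\|^2+\tau\|f(\cdot,t_{1/2})\|^2+\tau\sum_{i=1}^{m-1}\|f(\cdot,t_{i+\sigma_i})\|^2\Bigr).$$ -/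

import Mathlib

open MeasureTheory
open scoped Gradient

noncomputable section

namespace EnergyDG

/-! ### Meshes with periodic boundary identification -/

/-- `ℝᵈ` with the Euclidean norm. -/
abbrev Space (d : ℕ) : Type := EuclideanSpace ℝ (Fin d)

/-- The two families of affine elements: simplices, and tensor-product elements. -/
inductive ElementKind where
  | simplex
  | tensor

/-- The reference element: the unit simplex or the unit cube. -/
def referenceElement (d : ℕ) : ElementKind → Set (Space d)
  | .simplex => {x | (∀ i, 0 ≤ x i) ∧ ∑ i, x i ≤ 1}
  | .tensor => {x | ∀ i, 0 ≤ x i ∧ x i ≤ 1}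

/-- Polynomials of degree at most `s` on the reference element: total degree at most `s` on the
simplex, degree at most `s` in each variable on the cube. -/
def referencePolynomials (d : ℕ) (s : ℕ) : ElementKind → Submodule ℝ (MvPolynomial (Fin d) ℝ)
  | .simplex => MvPolynomial.restrictTotalDegree (Fin d) ℝ s
  | .tensor => MvPolynomial.restrictDegree (Fin d) ℝ s

/-- The space `𝒫ˢ(K)` on the image `K` of the reference element under the affine bijection `A`:
the functions `p ∘ A⁻¹` with `p` a reference polynomial. As polynomials are determined by their
values on `K`, they are regarded as functions on the whole space. -/
def localPolynomials {d : ℕ} (kind : ElementKind) (A : Space d ≃ᵃ[ℝ] Space d) (s : ℕ) :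
    Set (Space d → ℝ) :=
  {w | ∃ p ∈ referencePolynomials d s kind, ∀ x, w x = MvPolynomial.eval (A.symm x) p}

/-- The vector of the period lattice with integer coordinates `z`. -/
def latticeVector {d : ℕ} (period : Module.Basis (Fin d) ℝ (Space d)) (z : Fin d → ℤ) : Space d :=
  ∑ i, (z i : ℝ) • period i

/-- The intersection of `A K̂` with the translate `A' K̂ + shift`, where `K̂` is the reference
element. -/
def interface {d : ℕ} (kind : ElementKind) (A A' : Space d ≃ᵃ[ℝ] Space d) (shift : Space d) :
    Set (Space d) :=
  (A '' referenceElement d kind) ∩ ((fun x => x + shift) '' (A' '' referenceElement d kind))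

/-- A tessellation of a `d`-dimensional periodicity cell by finitely many affine simplices, or
finitely many affine tensor-product elements.

The elements `K₀, …, K₍ₙ₋₁₎` do not overlap, not even after translation by the period lattice, and
their translates cover `ℝᵈ`; for a box `∏ᵢ [aᵢ, bᵢ]` and the periods `(bᵢ - aᵢ) eᵢ` this says that
they tessellate the box.

The finite set `faces` is the set of interelement faces, with periodic boundary faces identified:
the triple `(k, l, z)` stands for the face `F = K_k ∩ (K_l + λ)`, `λ` being the lattice vector with
coordinates `z`, and for the labelling `K⁻ = K_k`, `K⁺ = K_l` of the two elements that share it.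
`(l, k, -z)` is the same face up to a translation by a period, with the other labelling. Each
intersection of positive `(d-1)`-dimensional measure occurs with exactly one of the two labellings,
which may be chosen freely. -/
structure PeriodicMesh (d : ℕ) where
  kind : ElementKind
  period : Module.Basis (Fin d) ℝ (Space d)
  card : ℕ
  map : Fin card → (Space d ≃ᵃ[ℝ] Space d)
  covers : ∀ x : Space d, ∃ k z, x ∈
    (fun y => y + latticeVector period z) '' (map k '' referenceElement d kind)
  nonoverlapping : ∀ k l z, (k ≠ l ∨ z ≠ 0) → Disjoint
    (interior (map k '' referenceElement d kind))
    (interior ((fun y => y + latticeVector period z) '' (map l '' referenceElement d kind)))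
  faces : Finset (Fin card × Fin card × (Fin d → ℤ))
  mem_faces_or_swap : ∀ k l z, ((k, l, z) ∈ faces ∨ (l, k, -z) ∈ faces) ↔
    ((k ≠ l ∨ z ≠ 0) ∧
      (μHE[d - 1] : Measure (Space d))
        (interface kind (map k) (map l) (latticeVector period z)) ≠ 0)
  not_swap_mem_faces : ∀ k l z, (k, l, z) ∈ faces → (l, k, -z) ∉ faces

/-- A unit vector `ν` is an outward unit normal to the convex set `K` along `F ⊆ ∂K` if `F` lies in
a hyperplane `⟪ν, x⟫ = c` and `K` lies in the half-space `⟪ν, x⟫ ≤ c`. -/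
def IsOutwardUnitNormal {d : ℕ} (K F : Set (Space d)) (ν : Space d) : Prop :=
  ‖ν‖ = 1 ∧ ∃ c : ℝ, (∀ x ∈ K, inner ℝ ν x ≤ c) ∧ ∀ x ∈ F, inner ℝ ν x = c

open Classical in
/-- The outward unit normal to `K` along `F`. It exists and is unique when `K` is an element of a
mesh and `F` one of its faces. -/
def outwardUnitNormal {d : ℕ} (K F : Set (Space d)) : Space d :=
  if h : ∃ ν, IsOutwardUnitNormal K F ν then h.choose else 0

/-- The two sides `K⁻`, `K⁺` of a face. -/
inductive Side where
  | minus
  | plus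

namespace PeriodicMesh

variable {d : ℕ} (𝒯 : PeriodicMesh d)

/-- The element `K_k`. -/
def element (k : Fin 𝒯.card) : Set (Space d) := 𝒯.map k '' referenceElement d 𝒯.kind

/-- The (closed) computational domain `Ω_h`. -/
def domain : Set (Space d) := ⋃ k, 𝒯.element k

/-- Families of functions, one for each element, representing functions on `Ω_h` that may be
discontinuous across element interfaces. -/
abbrev Broken : Type := Fin 𝒯.card → Space d → ℝ

/-- The space of piecewise polynomials of degree at most `s`. -/
def polySpace (s : ℕ) : Set 𝒯.Broken :=
  {w | ∀ k, w k ∈ localPolynomials 𝒯.kind (𝒯.map k) s}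

/-- The squared norm `‖w‖²` in `L²(Ω_h)`. -/
def normSq (w : 𝒯.Broken) : ℝ := ∑ k, ∫ x in 𝒯.element k, (w k x) ^ 2

/-- The squared norm `‖∇_h w‖²` in `L²(Ω_h)` of the elementwise gradient. -/
def gradNormSq (w : 𝒯.Broken) : ℝ := ∑ k, ∫ x in 𝒯.element k, ‖∇ (w k) x‖ ^ 2

/-! ### Faces, traces, jumps and numerical fluxes -/

/-- Labels of interelement faces: `(k, l, z)` labels `K_k ∩ (K_l + λ)`, `λ` having coordinates
`z`. -/
abbrev Face : Type := Fin 𝒯.card × Fin 𝒯.card × (Fin d → ℤ)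

/-- The face as a subset of the boundary of `K⁻`. -/
def faceSet (F : 𝒯.Face) : Set (Space d) :=
  interface 𝒯.kind (𝒯.map F.1) (𝒯.map F.2.1) (latticeVector 𝒯.period F.2.2)

/-- The elements `K⁻` and `K⁺`. -/
def sideElement : Side → 𝒯.Face → Fin 𝒯.card
  | .minus, F => F.1
  | .plus, F => F.2.1

/-- The point of the boundary of `K⁻` or `K⁺` that is identified, by periodicity, with the point
`x` of the face. -/
def sidePoint : Side → 𝒯.Face → Space d → Space d
  | .minus, _, x => x
  | .plus, F, x => x - latticeVector 𝒯.period F.2.2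

/-- The outward unit normals `n⁻` to `K⁻` and `n⁺ = -n⁻` to `K⁺` along the face. -/
def normal : Side → 𝒯.Face → Space d
  | .minus, F => outwardUnitNormal (𝒯.element F.1) (𝒯.faceSet F)
  | .plus, F => -outwardUnitNormal (𝒯.element F.1) (𝒯.faceSet F)

/-- The traces `w⁻`, `w⁺` on a face. -/
def trace (s : Side) (w : 𝒯.Broken) (F : 𝒯.Face) (x : Space d) : ℝ :=
  w (𝒯.sideElement s F) (𝒯.sidePoint s F x)

/-- The traces `∇w⁻`, `∇w⁺` on a face. -/
def gradTrace (s : Side) (w : 𝒯.Broken) (F : 𝒯.Face) (x : Space d) : Space d :=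
  ∇ (w (𝒯.sideElement s F)) (𝒯.sidePoint s F x)

/-- The jump `[w] = w⁻ n⁻ + w⁺ n⁺`. -/
def jump (w : 𝒯.Broken) (F : 𝒯.Face) (x : Space d) : Space d :=
  𝒯.trace .minus w F x • 𝒯.normal .minus F + 𝒯.trace .plus w F x • 𝒯.normal .plus F

/-- The jump `[∇w] = ∇w⁻ · n⁻ + ∇w⁺ · n⁺`. -/
def gradJump (w : 𝒯.Broken) (F : 𝒯.Face) (x : Space d) : ℝ :=
  inner ℝ (𝒯.gradTrace .minus w F x) (𝒯.normal .minus F) +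
    inner ℝ (𝒯.gradTrace .plus w F x) (𝒯.normal .plus F)

/-- The numerical flux `v* = θ v⁺ + (1 - θ) v⁻ - ζ [∇u]`. -/
def fluxV (θ ζ : ℝ) (u v : 𝒯.Broken) (F : 𝒯.Face) (x : Space d) : ℝ :=
  θ * 𝒯.trace .plus v F x + (1 - θ) * 𝒯.trace .minus v F x - ζ * 𝒯.gradJump u F x

/-- The numerical flux `(∇u)* = (1 - θ) ∇u⁺ + θ ∇u⁻ - γ [v]`. -/
def fluxGradU (θ γ : ℝ) (u v : 𝒯.Broken) (F : 𝒯.Face) (x : Space d) : Space d :=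
  (1 - θ) • 𝒯.gradTrace .plus u F x + θ • 𝒯.gradTrace .minus u F x - γ • 𝒯.jump v F x

/-- The surface integral over `∂K_k`, as the sum of the integrals over the faces of `K_k`.
`g s F x` is the integrand seen from the side `s` of the face `F`. A face both of whose sides
belong to `K_k` (by periodicity) contributes twice. -/
def boundaryIntegral (k : Fin 𝒯.card) (g : Side → 𝒯.Face → Space d → ℝ) : ℝ :=
  ∑ F ∈ 𝒯.faces,
    ((if 𝒯.sideElement .minus F = k then ∫ x in 𝒯.faceSet F, g .minus F x ∂μHE[d - 1] else 0) +
      (if 𝒯.sideElement .plus F = k then ∫ x in 𝒯.faceSet F, g .plus F x ∂μHE[d - 1] else 0))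

/-- The spatial discretization at one time level: for all piecewise polynomials `φ`, `ψ` of degrees
at most `qu`, `qv` and on every element `K`,

`∫_K ∇φ · ∇(du - v) = ∫_{∂K} (∇φ · n) (v* - v)`,

`∫_K ψ dv + ∇ψ · ∇u + ψ D = ∫_K ψ f + ∫_{∂K} ψ (∇u)* · n`,

where `du`, `dv`, `D` approximate `∂u/∂t`, `∂v/∂t` and the fractional derivative of `v`. -/
def DGEquations (θ γ ζ : ℝ) (qu qv : ℕ) (u v du dv D : 𝒯.Broken) (f : Space d → ℝ) : Prop :=
  (∀ φ ∈ 𝒯.polySpace qu, ∀ k,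
    ∫ x in 𝒯.element k, inner ℝ (∇ (φ k) x) (∇ (du k - v k) x) =
      𝒯.boundaryIntegral k fun s F x =>
        inner ℝ (𝒯.gradTrace s φ F x) (𝒯.normal s F) *
          (𝒯.fluxV θ ζ u v F x - 𝒯.trace s v F x)) ∧
  (∀ ψ ∈ 𝒯.polySpace qv, ∀ k,
    ∫ x in 𝒯.element k, (ψ k x * dv k x + inner ℝ (∇ (ψ k) x) (∇ (u k) x) + ψ k x * D k x) =
      (∫ x in 𝒯.element k, ψ k x * f x) +
        𝒯.boundaryIntegral k fun s F x =>
          𝒯.trace s ψ F x * inner ℝ (𝒯.fluxGradU θ γ u v F x) (𝒯.normal s F))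

end PeriodicMesh

/-! ### Time discretization -/

/-- `σ ∈ (1/2, 1)` is a root of `σ - (1 - α(t_m + σ τ) / 2) = 0`, where `t_m = m τ`. -/
def IsIntermediatePoint (α : ℝ → ℝ) (τ : ℝ) (m : ℕ) (σ : ℝ) : Prop :=
  σ ∈ Set.Ioo (1 / 2 : ℝ) 1 ∧ σ - (1 - α (m * τ + σ * τ) / 2) = 0

/-- The weights `c_i^{(m)}`, `0 ≤ i ≤ m`, `1 ≤ m`, as functions of `a = α_{m+σ_m}` and
`σ = σ_m`. -/
def coeffC (a σ : ℝ) (m i : ℕ) : ℝ :=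
  if i = 0 then
    ((1 + σ) ^ (2 - a) - σ ^ (2 - a)) / (2 - a) - ((1 + σ) ^ (1 - a) - σ ^ (1 - a)) / 2
  else if i < m then
    ((i + σ + 1) ^ (2 - a) - 2 * (i + σ) ^ (2 - a) + (i + σ - 1) ^ (2 - a)) / (2 - a) -
      ((i + σ + 1) ^ (1 - a) - 2 * (i + σ) ^ (1 - a) + (i + σ - 1) ^ (1 - a)) / 2
  else
    (3 * (i + σ) ^ (1 - a) - (i + σ - 1) ^ (1 - a)) / 2 -
      ((i + σ) ^ (2 - a) - (i + σ - 1) ^ (2 - a)) / (2 - a)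

/-- The weights `a_i^{(m)} = c_i^{(m)} / s_m`, `s_m = τ^a Γ(2 - a)`, `a = α(t_m + σ τ)`, where
`σ = σ_m` and `m ≥ 1`. -/
def coeffA (α : ℝ → ℝ) (τ σ : ℝ) (m i : ℕ) : ℝ :=
  let a := α (m * τ + σ * τ)
  coeffC a σ m i / (τ ^ a * Real.Gamma (2 - a))

/-- `s_0 = 2^(1-a) τ^a Γ(2 - a)` with `a = α(τ / 2)`. -/
def initialScale (α : ℝ → ℝ) (τ : ℝ) : ℝ :=
  let a := α (τ / 2)
  (2 : ℝ) ^ (1 - a) * τ ^ a * Real.Gamma (2 - a)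

section Differences

variable {X : Type*} [AddCommGroup X] [Module ℝ X]

/-- `w^{m+σ} = σ w^{m+1} + (1 - σ) w^m`. -/
def average (σ : ℝ) (w : ℕ → X) (m : ℕ) : X := σ • w (m + 1) + (1 - σ) • w m

/-- `δ_t w^{m+σ} = ((2σ+1) w^{m+1} - 4σ w^m + (2σ-1) w^{m-1}) / (2τ)`, for `m ≥ 1`. -/
def timeDiff (τ σ : ℝ) (w : ℕ → X) (m : ℕ) : X :=
  (2 * τ)⁻¹ • ((2 * σ + 1) • w (m + 1) - (4 * σ) • w m + (2 * σ - 1) • w (m - 1))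

end Differences

/-- The fully discrete scheme on the time levels `0, …, M` with step size `τ`: the sequences
`u`, `v` of piecewise polynomials satisfy the initial step for `m = 0` and the general step for
`1 ≤ m ≤ M - 1`. The extra equations that fix the mean value of `u` on each element are not
imposed, so that solutions of the scheme with these equations are a special case. -/
structure IsDGSolution {d : ℕ} (𝒯 : PeriodicMesh d) (qu qv : ℕ) (θ γ ζ : ℝ) (α : ℝ → ℝ)
    (σ : ℕ → ℝ) (f : ℝ → Space d → ℝ) (M : ℕ) (τ : ℝ) (u v : ℕ → 𝒯.Broken) : Prop where
  u_mem : ∀ m ≤ M, u m ∈ 𝒯.polySpace qu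
  v_mem : ∀ m ≤ M, v m ∈ 𝒯.polySpace qv
  initial_step : 𝒯.DGEquations θ γ ζ qu qv (average (1 / 2) u 0) (average (1 / 2) v 0)
    (τ⁻¹ • (u 1 - u 0)) (τ⁻¹ • (v 1 - v 0)) ((initialScale α τ)⁻¹ • (v 1 - v 0)) (f (τ / 2))
  general_step : ∀ m, 1 ≤ m → m < M →
    𝒯.DGEquations θ γ ζ qu qv (average (σ m) u m) (average (σ m) v m)
      (timeDiff τ (σ m) u m) (timeDiff τ (σ m) v m)
      (∑ i ∈ Finset.range (m + 1), coeffA α τ (σ m) m (m - i) • (v (i + 1) - v i))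
      (f (m * τ + σ m * τ))

end EnergyDG

end

/-! This is an energy argument in which everything that depends on the mesh cancels exactly.

In space, test the first equation with `u` and the second with `v`, both at the intermediate time.
The two volume terms `(∇u, ∇v)` cancel. On each face the `θ`-terms cancel, leaving `-γ |[v]|²` and
`-ζ [∇u]²`. Hence `(∇u, ∇ ∂u) + (v, ∂v) + (v, D) ≤ (‖v‖² + ‖f‖²) / 2`, where `∂` is the discrete
time derivative and `D` the discrete fractional derivative of `v` (`energy_le_of_DGEquations`). No
inverse or trace inequality enters, so the constants do not see the mesh or the degrees. From there
on only two symmetric nonnegative bilinear forms on pairs `(u, v)` remain: `B = ‖v‖²` and `Q = ‖∇u‖²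
+ ‖v‖²`.

In time, put `p = 2σ - 1 = 1 - a`. The three-level difference paired with the average dominates the
increment of a quadratic energy of two consecutive levels, which controls half of `Q`
(`pairEnergy_sub_le`, `half_le_pairEnergy`). The fractional term is bounded below by half the same
convolution applied to `B (w i) (w i)` (`half_sum_le_bilin_average`). This needs nonnegative
decreasing weights with `σ² a_1 ≤ (2σ - 1) a_0`. These properties hold because, for `σ = 1 - a / 2`,
the weights are second differences of the explicit function `shape p`, whose second derivative is
positive and decreasing. The zeroth and last weights are treated separately.

Since the order varies in time, both `p` and the weights change from step to step, and neither
energy telescopes exactly. By the Lipschitz bound on `α`, changing `p` costs `O(τ)`. Changing the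
`i`-th weight costs `O(τ) k_i`, where `k_i = (max i 1 * τ) ^ (-(1 + A) / 2)` and `A = max α < 1`.
Differentiating a power in its exponent produces a logarithm, which is absorbed by raising the
singularity from `A` to `(1 + A) / 2`; this is still below `1`, so `τ ∑ k_i` stays bounded
(`exists_nodeWeight_bounds`, `sum_singularKernel_le`). Discrete Grönwall, applied to the running
maximum of `Q` because the memory reaches all earlier levels, finishes the proof
(`exists_stability_constant`). -/

namespace EnergyDG

/-! ### The weights of the time discretization -/

/-- A second difference is a multiple in `(0, 2)` of an intermediate value of the second
derivative. -/
theorem exists_second_difference_eq {f f' f'' : ℝ → ℝ} {c : ℝ}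
    (hf : ∀ y ∈ Set.Icc (c - 1) (c + 1), HasDerivAt f (f' y) y)
    (hf' : ∀ y ∈ Set.Icc (c - 1) (c + 1), HasDerivAt f' (f'' y) y) :
    ∃ η ∈ Set.Icc (c - 1) (c + 1), ∃ s ∈ Set.Ioo (0 : ℝ) 2,
      f (c + 1) - 2 * f c + f (c - 1) = s * f'' η := by
  obtain ⟨y₁, ⟨h₁, h₁'⟩, e₁⟩ := exists_hasDerivAt_eq_slope f f' (show c < c + 1 by linarith)
    (fun y hy => (hf y ⟨by linarith [hy.1], hy.2⟩).continuousAt.continuousWithinAt)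
    (fun y hy => hf y ⟨by linarith [hy.1], hy.2.le⟩)
  obtain ⟨y₀, ⟨h₀, h₀'⟩, e₀⟩ := exists_hasDerivAt_eq_slope f f' (show c - 1 < c by linarith)
    (fun y hy => (hf y ⟨hy.1, by linarith [hy.2]⟩).continuousAt.continuousWithinAt)
    (fun y hy => hf y ⟨hy.1.le, by linarith [hy.2]⟩)
  have h : y₀ < y₁ := by linarith
  obtain ⟨η, ⟨h₂, h₂'⟩, e₂⟩ := exists_hasDerivAt_eq_slope f' f'' h
    (fun y hy => (hf' y ⟨by linarith [hy.1], by linarith [hy.2]⟩).continuousAt.continuousWithinAt)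
    (fun y hy => hf' y ⟨by linarith [hy.1], by linarith [hy.2]⟩)
  -- The factor is the distance between the mean-value points of the two adjacent first differences.
  -- Only its bounds matter later, so the sharper value `1` of the standard second-difference
  -- formula is not needed.
  refine ⟨η, ⟨by linarith, by linarith⟩, y₁ - y₀, ⟨by linarith, by linarith⟩, ?_⟩
  rw [e₂, mul_div_cancel₀ _ (by linarith), e₁, e₀]
  rw [show c + 1 - c = 1 by ring, show c - (c - 1) = 1 by ring]
  ring

/-- The function whose second differences are the weights, in terms of `p = 1 - a = 2σ - 1`. -/
noncomputable def shape (p y : ℝ) : ℝ := y * (y + (1 + p) / 2) ^ p / (1 + p)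

/-- The first derivative of `shape p`. -/
noncomputable def shapeDeriv (p y : ℝ) : ℝ :=
  (y + (1 + p) / 2) ^ p - p / 2 * (y + (1 + p) / 2) ^ (p - 1)

/-- The second derivative of `shape p`. -/
noncomputable def shapeDeriv₂ (p y : ℝ) : ℝ :=
  p * (y + (1 + p) / 2) ^ (p - 1) * (1 + (1 - p) / (2 * y + 1 + p))

theorem hasDerivAt_add_rpow {y : ℝ} (s c : ℝ) (h : 0 < y + c) :
    HasDerivAt (fun y : ℝ => (y + c) ^ s) (s * (y + c) ^ (s - 1)) y := by
  have := ((hasDerivAt_id y).add_const c).rpow_const (p := s) (Or.inl h.ne')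
  simpa [mul_comm] using this

theorem hasDerivAt_shape {p y : ℝ} (hp : 0 < p) (hy : 0 ≤ y) :
    HasDerivAt (shape p) (shapeDeriv p y) y := by
  have hx : 0 < y + (1 + p) / 2 := by linarith
  have h := ((hasDerivAt_id y).mul (hasDerivAt_add_rpow p _ hx)).div_const (1 + p)
  refine h.congr_deriv ?_
  have e : (y + (1 + p) / 2) ^ p = (y + (1 + p) / 2) ^ (p - 1) * (y + (1 + p) / 2) := by
    rw [← Real.rpow_add_one hx.ne']; ring_nf
  have : (1 + p) ≠ 0 := by linarith
  simp only [shapeDeriv, id, e]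
  field_simp
  ring

theorem hasDerivAt_shapeDeriv {p y : ℝ} (hp : 0 < p) (hy : 0 ≤ y) :
    HasDerivAt (shapeDeriv p) (shapeDeriv₂ p y) y := by
  have hx : 0 < y + (1 + p) / 2 := by linarith
  have h := (hasDerivAt_add_rpow p _ hx).sub
    ((hasDerivAt_add_rpow (p - 1) _ hx).const_mul (p / 2))
  refine h.congr_deriv ?_
  have e : (y + (1 + p) / 2) ^ (p - 1) = (y + (1 + p) / 2) ^ (p - 1 - 1) * (y + (1 + p) / 2) := by
    rw [← Real.rpow_add_one hx.ne']; ring_nf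
  have : 2 * y + 1 + p ≠ 0 := by linarith
  simp only [shapeDeriv₂, e]
  field_simp
  ring

/-- The `i`-th generic weight, `i ≥ 1`. -/
noncomputable def shapeDiff (p i : ℝ) : ℝ := shape p (i + 1) - 2 * shape p i + shape p (i - 1)

theorem shapeDeriv₂_nonneg {p y : ℝ} (hp : p ∈ Set.Ioo (0 : ℝ) 1) (hy : 0 ≤ y) :
    0 ≤ shapeDeriv₂ p y := by
  have h0 := hp.1
  have h1 : 0 < 1 - p := by linarith [hp.2]
  unfold shapeDeriv₂; positivity

theorem shapeDeriv₂_anti {p y z : ℝ} (hp : p ∈ Set.Ioo (0 : ℝ) 1) (hy : 0 ≤ y) (hyz : y ≤ z) :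
    shapeDeriv₂ p z ≤ shapeDeriv₂ p y := by
  have h0 := hp.1
  have h1 : 0 < 1 - p := by linarith [hp.2]
  have h2 : (z + (1 + p) / 2) ^ (p - 1) ≤ (y + (1 + p) / 2) ^ (p - 1) :=
    Real.rpow_le_rpow_of_nonpos (by linarith) (by linarith) (by linarith)
  have h3 : (1 - p) / (2 * z + 1 + p) ≤ (1 - p) / (2 * y + 1 + p) := by gcongr
  have h4 : 0 < (2 * z + 1 + p) := by linarith
  unfold shapeDeriv₂
  gcongr

theorem exists_shapeDiff_eq {p i : ℝ} (hp : p ∈ Set.Ioo (0 : ℝ) 1) (hi : 1 ≤ i) :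
    ∃ η ∈ Set.Icc (i - 1) (i + 1), ∃ s ∈ Set.Ioo (0 : ℝ) 2,
      shapeDiff p i = s * shapeDeriv₂ p η :=
  exists_second_difference_eq (fun y hy => hasDerivAt_shape hp.1 (by linarith [hy.1]))
    (fun y hy => hasDerivAt_shapeDeriv hp.1 (by linarith [hy.1]))

theorem shapeDiff_nonneg {p i : ℝ} (hp : p ∈ Set.Ioo (0 : ℝ) 1) (hi : 1 ≤ i) :
    0 ≤ shapeDiff p i := by
  obtain ⟨η, hη, s, hs, e⟩ := exists_shapeDiff_eq hp hi
  rw [e]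
  exact mul_nonneg hs.1.le (shapeDeriv₂_nonneg hp (by linarith [hη.1]))

/-- The difference of two neighbouring weights is itself a second difference, of `y ↦ shape p y -
shape p (y + 1)`, and this function is convex because `shapeDeriv₂ p` decreases. -/
theorem shapeDiff_anti {p i : ℝ} (hp : p ∈ Set.Ioo (0 : ℝ) 1) (hi : 1 ≤ i) :
    shapeDiff p (i + 1) ≤ shapeDiff p i := by
  have h : ∀ y ∈ Set.Icc (i - 1) (i + 1),
      HasDerivAt (fun y => shape p y - shape p (y + 1)) (shapeDeriv p y - shapeDeriv p (y + 1)) y :=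
    fun y hy => (hasDerivAt_shape hp.1 (by linarith [hy.1])).sub
      ((hasDerivAt_shape (y := y + 1) hp.1 (by linarith [hy.1])).comp_add_const y 1)
  have h' : ∀ y ∈ Set.Icc (i - 1) (i + 1),
      HasDerivAt (fun y => shapeDeriv p y - shapeDeriv p (y + 1))
        (shapeDeriv₂ p y - shapeDeriv₂ p (y + 1)) y :=
    fun y hy => (hasDerivAt_shapeDeriv hp.1 (by linarith [hy.1])).sub
      ((hasDerivAt_shapeDeriv (y := y + 1) hp.1 (by linarith [hy.1])).comp_add_const y 1)
  obtain ⟨η, hη, s, hs, e⟩ := exists_second_difference_eq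
    (f'' := fun y => shapeDeriv₂ p y - shapeDeriv₂ p (y + 1)) h h'
  have h2 : 0 ≤ s * (shapeDeriv₂ p η - shapeDeriv₂ p (η + 1)) :=
    mul_nonneg hs.1.le (sub_nonneg.2 (shapeDeriv₂_anti hp (by linarith [hη.1]) (by linarith)))
  rw [← e] at h2
  unfold shapeDiff
  rw [show i - 1 + 1 = i by ring] at h2
  rw [show i + 1 - 1 = i by ring]
  linarith

/-- The last weight. -/
noncomputable def shapeLast (p m : ℝ) : ℝ := (m + (1 + p) / 2) ^ p - (shape p m - shape p (m - 1))

/-- Bernoulli's inequality in the form `y ^ p ≤ x ^ p + p x ^ (p - 1) (y - x)`. -/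
theorem rpow_le_tangent {p x y : ℝ} (hp : p ∈ Set.Ioo (0 : ℝ) 1) (hx : 0 < x) (hy : 0 ≤ y) :
    y ^ p ≤ x ^ p * (1 + p * ((y - x) / x)) := by
  have h := rpow_one_add_le_one_add_mul_self (s := (y - x) / x)
    (by rw [sub_div, div_self hx.ne']; linarith [div_nonneg hy hx.le]) hp.1.le hp.2.le
  have e : y = x * (1 + (y - x) / x) := by field_simp; ring
  have h0 : 0 ≤ 1 + (y - x) / x := by rw [sub_div, div_self hx.ne']; linarith [div_nonneg hy hx.le]
  calc y ^ p = x ^ p * (1 + (y - x) / x) ^ p := by rw [← Real.mul_rpow hx.le h0, ← e]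
    _ ≤ _ := by gcongr

/-- After clearing `1 + p`, the claim compares `(m - 1 - p) (m + σ) ^ p` with `(m - 1) (m - 1 + σ) ^
p`. Bernoulli bounds the ratio of the powers by `1 + p / (m - 1)`, and `(m - 1 - p) (1 + p / (m -
1)) = (m - 1) - p² / (m - 1)`. For `m - 1 ≤ p` the left side is not positive. -/
theorem shapeLast_nonneg {p m : ℝ} (hp : p ∈ Set.Ioo (0 : ℝ) 1) (hm : 1 ≤ m) :
    0 ≤ shapeLast p m := by
  have h0 := hp.1
  have h1 := hp.2
  have hx : 0 < m - 1 + (1 + p) / 2 := by linarith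
  have hb := rpow_le_tangent hp hx (y := m + (1 + p) / 2) (by linarith)
  have hq : 0 < (m - 1 + (1 + p) / 2) ^ p := by positivity
  have hq' : 0 < (m + (1 + p) / 2) ^ p := by positivity
  have key : (m - 1 - p) * (m + (1 + p) / 2) ^ p ≤ (m - 1) * (m - 1 + (1 + p) / 2) ^ p := by
    rcases le_or_gt (m - 1 - p) 0 with h | h
    · nlinarith [mul_nonneg (sub_nonneg.2 hm) hq.le]
    · refine (mul_le_mul_of_nonneg_left hb h.le).trans ?_
      rw [mul_comm (m - 1), mul_left_comm]
      gcongr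
      rw [show m + (1 + p) / 2 - (m - 1 + (1 + p) / 2) = 1 by ring]
      have : 1 / (m - 1 + (1 + p) / 2) ≤ 1 / (m - 1) := by
        apply one_div_le_one_div_of_le <;> linarith
      calc (m - 1 - p) * (1 + p * (1 / (m - 1 + (1 + p) / 2)))
          ≤ (m - 1 - p) * (1 + p * (1 / (m - 1))) := by gcongr
        _ = (m - 1) - p ^ 2 / (m - 1) := by
          have : m - 1 ≠ 0 := by linarith
          field_simp; ring
        _ ≤ m - 1 := by
          have : 0 < m - 1 := by linarith
          have : 0 ≤ p ^ 2 / (m - 1) := by positivity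
          linarith
  have e : shapeLast p m = ((m - 1) * (m - 1 + (1 + p) / 2) ^ p
      - (m - 1 - p) * (m + (1 + p) / 2) ^ p) / (1 + p) := by
    unfold shapeLast shape
    field_simp
    ring
  rw [e]
  apply div_nonneg <;> linarith

/-- The gap between the generic and the last weight is the error of the trapezoidal rule for `s ↦ s
^ p` on an interval of length one, which has a sign because this function is concave. The bound
gives both monotonicity at the last index and an upper bound by the generic weight. -/
theorem shapeLast_le {p m : ℝ} (hp : p ∈ Set.Ioo (0 : ℝ) 1) (hm : 1 ≤ m) :
    shapeLast p m ≤ shapeDiff p m := by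
  have h0 := hp.1
  have h1 := hp.2
  have hx : 0 < m + (1 + p) / 2 := by linarith
  set x := m + (1 + p) / 2 with hxd
  -- the error of the trapezoidal rule for `s ↦ s ^ p` on `[x, x + t]`
  let g : ℝ → ℝ := fun t => (t + x) ^ (p + 1) / (p + 1) - t / 2 * (x ^ p + (t + x) ^ p)
  have hg : ∀ t ∈ Set.Icc (0 : ℝ) 1, HasDerivAt g
      ((t + x) ^ p - (1 / 2 * (x ^ p + (t + x) ^ p) + t / 2 * (p * (t + x) ^ (p - 1)))) t := by
    intro t ht
    have hxt : 0 < t + x := by linarith [ht.1]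
    have h := ((hasDerivAt_add_rpow (p + 1) _ hxt).div_const (p + 1)).sub
      (((hasDerivAt_id t).div_const 2).mul ((hasDerivAt_add_rpow p _ hxt).const_add (x ^ p)))
    refine h.congr_deriv ?_
    have : p + 1 ≠ 0 := by linarith
    simp only [id, add_sub_cancel_right]
    field_simp
  obtain ⟨t, ht, e⟩ := exists_hasDerivAt_eq_slope g _ (zero_lt_one)
    (fun y hy => (hg y hy).continuousAt.continuousWithinAt)
    (fun y hy => hg y ⟨hy.1.le, hy.2.le⟩)
  have hxt : 0 < t + x := by linarith [ht.1]
  -- Twice the derivative of `g` is `(t + x) ^ p - x ^ p - t p (t + x) ^ (p - 1)`, so `g' ≥ 0` is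
  -- the tangent inequality at `t + x`, evaluated at `x`.
  have hb := rpow_le_tangent hp hxt hx.le
  have e1 : (t + x) ^ p = (t + x) ^ (p - 1) * (t + x) := by
    rw [← Real.rpow_add_one hxt.ne']; ring_nf
  have hb' : x ^ p ≤ (t + x) ^ p - t * (p * (t + x) ^ (p - 1)) := by
    refine hb.trans (le_of_eq ?_)
    rw [e1]; field_simp; ring
  have hg01 : g 0 ≤ g 1 := by
    rw [sub_zero, div_one] at e
    linarith
  simp only [g] at hg01
  have e2 : (x : ℝ) ^ (p + 1) = x ^ p * x := Real.rpow_add_one hx.ne' p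
  have e3 : (1 + x : ℝ) ^ (p + 1) = (1 + x) ^ p * (1 + x) :=
    Real.rpow_add_one (by linarith) p
  have : shapeDiff p m - shapeLast p m = (1 + x) ^ p * (m + 1) / (1 + p) - x ^ p * m / (1 + p)
      - x ^ p := by
    unfold shapeLast shapeDiff shape
    rw [show m + 1 + (1 + p) / 2 = 1 + x by rw [hxd]; ring, ← hxd]
    ring
  have e4 : (1 + x) ^ p * (m + 1) / (1 + p) - x ^ p * m / (1 + p) - x ^ p
      = (1 + x) ^ (p + 1) / (p + 1) - 1 / 2 * (x ^ p + (1 + x) ^ p) - x ^ (p + 1) / (p + 1) := by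
    rw [e2, e3]
    have : p + 1 ≠ 0 := by linarith
    have : 1 + p ≠ 0 := by linarith
    field_simp
    rw [hxd]; ring
  simp only [zero_add, zero_div, zero_mul, sub_zero] at hg01
  linarith

theorem shape_zero (p : ℝ) : shape p 0 = 0 := by simp [shape]

/-- As `shape p 0 = 0`, only `(2 + σ) ^ p` and `(1 + σ) ^ p` occur, and Bernoulli with `1 + σ ≥ 1 +
p` suffices. The inequality is the source of the condition on the first two weights in Alikhanov's
inequality. -/
theorem shapeDiff_one_le {p : ℝ} (hp : p ∈ Set.Ioo (0 : ℝ) 1) :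
    (1 + p) / 2 * shapeDiff p 1 ≤ p * shape p 1 := by
  have h0 := hp.1
  have h1 := hp.2
  have hb := rpow_le_tangent hp (x := 1 + (1 + p) / 2) (y := 2 + (1 + p) / 2) (by linarith)
    (by linarith)
  have hq : 0 < (1 + (1 + p) / 2) ^ p := by positivity
  have hc : p * ((2 + (1 + p) / 2 - (1 + (1 + p) / 2)) / (1 + (1 + p) / 2)) ≤ p / (1 + p) := by
    rw [show 2 + (1 + p) / 2 - (1 + (1 + p) / 2) = 1 by ring, mul_one_div]
    gcongr; linarith
  have hb2 : (2 + (1 + p) / 2) ^ p ≤ (1 + (1 + p) / 2) ^ p * (1 + p / (1 + p)) :=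
    hb.trans (by gcongr)
  unfold shapeDiff
  rw [sub_self, shape_zero]
  unfold shape
  norm_num
  have e : (1 + (1 + p) / 2) ^ p * (1 + p / (1 + p)) =
      (1 + (1 + p) / 2) ^ p * (1 + 2 * p) / (1 + p) := by
    field_simp; ring
  rw [e, le_div_iff₀ (by linarith)] at hb2
  rw [← sub_nonneg]
  have : p * ((1 + (1 + p) / 2) ^ p / (1 + p)) - (1 + p) / 2 *
      (2 * (2 + (1 + p) / 2) ^ p / (1 + p) - 2 * ((1 + (1 + p) / 2) ^ p / (1 + p)))
      = ((1 + (1 + p) / 2) ^ p * (1 + 2 * p) - (2 + (1 + p) / 2) ^ p * (1 + p)) / (1 + p) := by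
    field_simp; ring
  rw [this]
  apply div_nonneg <;> linarith

theorem shapeDiff_one_le_shape {p : ℝ} (hp : p ∈ Set.Ioo (0 : ℝ) 1) :
    shapeDiff p 1 ≤ shape p 1 := by
  have h0 := hp.1
  have h1 := hp.2
  have h := shapeDiff_one_le hp
  have h2 := shapeDiff_nonneg hp le_rfl
  have h3 : 0 ≤ shape p 1 := by unfold shape; positivity
  nlinarith

/-! ### The weights in terms of `shape` -/

/-- The two power terms of each weight merge into one function vanishing at `x = σ` precisely
because `σ = (1 + p) / 2`, the relation that defines the intermediate point. -/
theorem rpow_div_sub_rpow_div {p x : ℝ} (hp : 0 < p) (hx : 0 < x) :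
    x ^ (1 + p) / (1 + p) - x ^ p / 2 = shape p (x - (1 + p) / 2) := by
  unfold shape
  rw [add_comm 1 p, Real.rpow_add_one hx.ne', sub_add_cancel]
  field_simp

theorem coeffC_zero {p : ℝ} (hp : 0 < p) (m : ℕ) :
    coeffC (1 - p) ((1 + p) / 2) m 0 = shape p 1 := by
  have e1 := rpow_div_sub_rpow_div hp (x := 1 + (1 + p) / 2) (by positivity)
  have e2 := rpow_div_sub_rpow_div hp (x := (1 + p) / 2) (by positivity)
  rw [sub_self, shape_zero] at e2
  rw [add_sub_cancel_right] at e1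
  rw [coeffC, if_pos rfl, show 2 - (1 - p) = 1 + p by ring, show 1 - (1 - p) = p by ring, ← e1]
  linear_combination -e2

theorem coeffC_of_lt {p : ℝ} (hp : 0 < p) {m i : ℕ} (h1 : 1 ≤ i) (h : i < m) :
    coeffC (1 - p) ((1 + p) / 2) m i = shapeDiff p i := by
  have hi : (1 : ℝ) ≤ i := by exact_mod_cast h1
  have e1 := rpow_div_sub_rpow_div hp (x := i + (1 + p) / 2 + 1) (by positivity)
  have e2 := rpow_div_sub_rpow_div hp (x := i + (1 + p) / 2) (by positivity)
  have e3 := rpow_div_sub_rpow_div hp (x := i + (1 + p) / 2 - 1) (by linarith)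
  rw [show (i : ℝ) + (1 + p) / 2 + 1 - (1 + p) / 2 = i + 1 by ring] at e1
  rw [show (i : ℝ) + (1 + p) / 2 - (1 + p) / 2 = i by ring] at e2
  rw [show (i : ℝ) + (1 + p) / 2 - 1 - (1 + p) / 2 = i - 1 by ring] at e3
  rw [coeffC, if_neg (by lia), if_pos h, show 2 - (1 - p) = 1 + p by ring,
    show 1 - (1 - p) = p by ring, shapeDiff, ← e1, ← e2, ← e3]
  ring

theorem coeffC_self {p : ℝ} (hp : 0 < p) {m : ℕ} (h1 : 1 ≤ m) :
    coeffC (1 - p) ((1 + p) / 2) m m = shapeLast p m := by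
  have hi : (1 : ℝ) ≤ m := by exact_mod_cast h1
  have e2 := rpow_div_sub_rpow_div hp (x := m + (1 + p) / 2) (by positivity)
  have e3 := rpow_div_sub_rpow_div hp (x := m + (1 + p) / 2 - 1) (by linarith)
  rw [show (m : ℝ) + (1 + p) / 2 - (1 + p) / 2 = m by ring] at e2
  rw [show (m : ℝ) + (1 + p) / 2 - 1 - (1 + p) / 2 = m - 1 by ring] at e3
  rw [coeffC, if_neg (by lia), if_neg (by lia), show 2 - (1 - p) = 1 + p by ring,
    show 1 - (1 - p) = p by ring, shapeLast, ← e2, ← e3]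
  ring

theorem coeffC_nonneg {p : ℝ} (hp : p ∈ Set.Ioo (0 : ℝ) 1) {m i : ℕ} (h1 : 1 ≤ m) (h : i ≤ m) :
    0 ≤ coeffC (1 - p) ((1 + p) / 2) m i := by
  have h0 := hp.1
  rcases Nat.eq_zero_or_pos i with rfl | hi
  · rw [coeffC_zero hp.1]; unfold shape; positivity
  · have hi' : (1 : ℝ) ≤ i := by exact_mod_cast hi
    rcases h.lt_or_eq with h | rfl
    · rw [coeffC_of_lt hp.1 hi h]; exact shapeDiff_nonneg hp hi'
    · rw [coeffC_self hp.1 hi]; exact shapeLast_nonneg hp hi'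

theorem coeffC_le_shapeDiff {p : ℝ} (hp : p ∈ Set.Ioo (0 : ℝ) 1) {m i : ℕ} (h1 : 1 ≤ i)
    (h : i ≤ m) : coeffC (1 - p) ((1 + p) / 2) m i ≤ shapeDiff p i := by
  have hi' : (1 : ℝ) ≤ i := by exact_mod_cast h1
  rcases h.lt_or_eq with h | rfl
  · rw [coeffC_of_lt hp.1 h1 h]
  · rw [coeffC_self hp.1 h1]; exact shapeLast_le hp hi'

theorem coeffC_succ_le {p : ℝ} (hp : p ∈ Set.Ioo (0 : ℝ) 1) {m i : ℕ} (h : i < m) :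
    coeffC (1 - p) ((1 + p) / 2) m (i + 1) ≤ coeffC (1 - p) ((1 + p) / 2) m i := by
  refine (coeffC_le_shapeDiff hp (by lia) (by lia)).trans ?_
  rcases Nat.eq_zero_or_pos i with rfl | hi
  · rw [coeffC_zero hp.1]; simpa using shapeDiff_one_le_shape hp
  · rw [coeffC_of_lt hp.1 hi h]
    push_cast
    exact shapeDiff_anti hp (by exact_mod_cast hi)

theorem coeffC_one_le {p : ℝ} (hp : p ∈ Set.Ioo (0 : ℝ) 1) {m : ℕ} (h : 1 ≤ m) :
    ((1 + p) / 2) ^ 2 * coeffC (1 - p) ((1 + p) / 2) m 1 ≤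
      p * coeffC (1 - p) ((1 + p) / 2) m 0 := by
  have h0 := hp.1
  have h2 := hp.2
  have h1 := coeffC_le_shapeDiff hp le_rfl h
  rw [Nat.cast_one] at h1
  have h3 := shapeDiff_one_le hp
  have h4 := shapeDiff_nonneg hp le_rfl
  rw [coeffC_zero hp.1]
  refine le_trans ?_ h3
  rw [sq, mul_assoc]
  gcongr
  nlinarith

/-! ### Dependence of the weights on the order of the fractional derivative -/

theorem abs_exp_sub_exp_le (A B : ℝ) :
    |Real.exp A - Real.exp B| ≤ |A - B| * (Real.exp A + Real.exp B) := by
  have key : ∀ A B : ℝ, Real.exp A - Real.exp B ≤ |A - B| * Real.exp A := fun A B => by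
    have h := Real.add_one_le_exp (B - A)
    have h2 : Real.exp B = Real.exp A * Real.exp (B - A) := by rw [← Real.exp_add]; ring_nf
    have h3 := le_abs_self (A - B)
    have h4 := Real.exp_pos A
    rw [h2]
    nlinarith
  have h1 := key A B
  have h2 := key B A
  rw [abs_sub_comm] at h2
  have h3 := mul_nonneg (abs_nonneg (A - B)) (Real.exp_pos A).le
  have h4 := mul_nonneg (abs_nonneg (A - B)) (Real.exp_pos B).le
  rw [abs_le]
  constructor <;> linarith

theorem abs_rpow_sub_rpow_le {x y : ℝ} (hx : 0 < x) (hy : 0 < y) (r s : ℝ) :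
    |x ^ r - y ^ s| ≤ |r * Real.log x - s * Real.log y| * (x ^ r + y ^ s) := by
  rw [Real.rpow_def_of_pos hx, Real.rpow_def_of_pos hy, mul_comm r, mul_comm s]
  exact abs_exp_sub_exp_le _ _

theorem abs_log_sub_log_le {x y : ℝ} (hx : 1 / 2 ≤ x) (hy : 1 / 2 ≤ y) :
    |Real.log x - Real.log y| ≤ 2 * |x - y| := by
  have key : ∀ x y : ℝ, 1 / 2 ≤ x → 1 / 2 ≤ y → Real.log x - Real.log y ≤ 2 * |x - y| := by
    intro x y hx hy
    rw [← Real.log_div (by linarith) (by linarith)]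
    refine (Real.log_le_sub_one_of_pos (by apply div_pos <;> linarith)).trans ?_
    rw [div_sub_one (by linarith), div_le_iff₀ (by linarith)]
    nlinarith [le_abs_self (x - y), abs_nonneg (x - y)]
  have h1 := key x y hx hy
  have h2 := key y x hy hx
  rw [abs_sub_comm] at h2
  rw [abs_le]
  constructor <;> linarith

/-- With `ε = (1 - A) / 2` the factor `1 + |log z|` is `O(z ^ (-ε))` on `(0, T]`, and `-A - ε = -(1
+ A) / 2`. The exponent remains above `-1`, so the resulting kernel is summable. -/
theorem exists_log_mul_rpow_le {A T : ℝ} (hA : A ∈ Set.Ioo (0 : ℝ) 1) (hT : 0 < T) :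
    ∃ C > 0, ∀ z ∈ Set.Ioc 0 T, ∀ r ∈ Set.Icc (-A) 0,
      (1 + |Real.log z|) * z ^ r ≤ C * z ^ (-((1 + A) / 2)) := by
  obtain ⟨hA0, hA1⟩ := hA
  set ε := (1 - A) / 2 with hε
  have hε0 : 0 < ε := by linarith
  refine ⟨((1 + T) * (1 + T) + 1 / ε) * (1 + T), by positivity, fun z hz r hr => ?_⟩
  obtain ⟨hz0, hzT⟩ := hz
  have h1 : z ^ r ≤ (1 + T) * z ^ (-A) := by
    have : z ^ r = z ^ (r + A) * z ^ (-A) := by rw [← Real.rpow_add hz0]; ring_nf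
    rw [this]
    gcongr
    calc z ^ (r + A) ≤ (1 + T) ^ (r + A) :=
          Real.rpow_le_rpow hz0.le (by linarith) (by linarith [hr.1])
      _ ≤ (1 + T) ^ (1 : ℝ) := Real.rpow_le_rpow_of_exponent_le (by linarith) (by linarith [hr.2])
      _ = 1 + T := Real.rpow_one _
  have h2 : 1 ≤ (1 + T) * z ^ (-ε) := by
    have h : z ^ ε ≤ 1 + T := by
      calc z ^ ε ≤ (1 + T) ^ ε := Real.rpow_le_rpow hz0.le (by linarith) hε0.le
        _ ≤ (1 + T) ^ (1 : ℝ) := Real.rpow_le_rpow_of_exponent_le (by linarith) (by linarith)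
        _ = 1 + T := Real.rpow_one _
    have h' : z ^ ε * z ^ (-ε) = 1 := by rw [← Real.rpow_add hz0]; simp
    exact h'.symm.le.trans (mul_le_mul_of_nonneg_right h (by positivity))
  have h3 : |Real.log z| ≤ T + 1 / ε * z ^ (-ε) := by
    have h4 : Real.log z ≤ T := (Real.log_le_sub_one_of_pos hz0).trans (by linarith)
    have h5 := Real.log_le_rpow_div (inv_pos.2 hz0).le hε0
    rw [Real.log_inv, Real.inv_rpow hz0.le, ← Real.rpow_neg hz0.le, div_eq_inv_mul,
      ← one_div] at h5
    have h6 : 0 ≤ 1 / ε * z ^ (-ε) := by positivity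
    rw [abs_le]
    constructor <;> linarith
  have h4 : 1 + |Real.log z| ≤ ((1 + T) * (1 + T) + 1 / ε) * z ^ (-ε) := by nlinarith
  calc (1 + |Real.log z|) * z ^ r
      ≤ (((1 + T) * (1 + T) + 1 / ε) * z ^ (-ε)) * ((1 + T) * z ^ (-A)) := by gcongr
    _ = ((1 + T) * (1 + T) + 1 / ε) * (1 + T) * (z ^ (-ε) * z ^ (-A)) := by ring
    _ = _ := by
      rw [← Real.rpow_add hz0]
      congr 2
      rw [hε]; ring

/-- The singular factor of the scaled second derivative of `shape p`. -/
noncomputable def scaledPower (τ p y : ℝ) : ℝ := (τ * (y + (1 + p) / 2)) ^ (p - 1)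

theorem scaledPower_eq {τ p y : ℝ} (hτ : 0 < τ) (hp : 0 < p) (hy : 0 ≤ y) :
    scaledPower τ p y = τ ^ (p - 1) * (y + (1 + p) / 2) ^ (p - 1) :=
  Real.mul_rpow hτ.le (by linarith)

theorem scaledPower_nonneg {τ p y : ℝ} (hτ : 0 < τ) (hp : 0 < p) (hy : 0 ≤ y) :
    0 ≤ scaledPower τ p y :=
  Real.rpow_nonneg (mul_nonneg hτ.le (by linarith)) _

/-- On this window `y + σ ≥ i - 1/2 ≥ i / 2`, so the singularity is that of the elapsed time `i τ`.
-/
theorem scaledPower_le {τ p y i : ℝ} (hτ : 0 < τ) (hp : p ∈ Set.Ioo (0 : ℝ) 1) (hi : 1 ≤ i)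
    (hy : y ∈ Set.Icc (i - 1) (i + 1)) : scaledPower τ p y ≤ 2 * (i * τ) ^ (p - 1) := by
  have h0 := hp.1
  have h1 := hp.2
  have h : (τ * (y + (1 + p) / 2)) ^ (p - 1) ≤ (1 / 2 * (i * τ)) ^ (p - 1) := by
    refine Real.rpow_le_rpow_of_nonpos (by positivity) ?_ (by linarith)
    nlinarith [hy.1]
  refine h.trans ?_
  rw [Real.mul_rpow (by norm_num) (by positivity)]
  gcongr
  rw [one_div, Real.inv_rpow (by norm_num), ← Real.rpow_neg (by norm_num)]
  calc (2 : ℝ) ^ (-(p - 1)) ≤ 2 ^ (1 : ℝ) :=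
        Real.rpow_le_rpow_of_exponent_le (by norm_num) (by linarith)
    _ = 2 := Real.rpow_one _

/-- Both the exponent and the base depend on the order. After taking logarithms the exponent
contributes `log` of the argument, which differs from `log (i τ)` by at most `2`, and the base
contributes a Lipschitz term, since it stays above `1/2`. Keeping `τ` inside the power matters: the
logarithm of `τ` alone would be unbounded uniformly in `i`. -/
theorem abs_scaledPower_sub_le {τ p q y i : ℝ} (hτ : 0 < τ) (hp : p ∈ Set.Ioo (0 : ℝ) 1)
    (hq : q ∈ Set.Ioo (0 : ℝ) 1) (hi : 1 ≤ i) (hy : y ∈ Set.Icc (i - 1) (i + 1)) :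
    |scaledPower τ p y - scaledPower τ q y| ≤
      |p - q| * (6 * (1 + |Real.log (i * τ)|) * ((i * τ) ^ (p - 1) + (i * τ) ^ (q - 1))) := by
  obtain ⟨hp0, hp1⟩ := hp
  obtain ⟨hq0, hq1⟩ := hq
  have hxp : 1 / 2 ≤ y + (1 + p) / 2 := by linarith [hy.1]
  have hxq : 1 / 2 ≤ y + (1 + q) / 2 := by linarith [hy.1]
  have hxp0 : 0 < y + (1 + p) / 2 := by linarith
  have hxq0 : 0 < y + (1 + q) / 2 := by linarith
  have hlog : |Real.log (τ * (y + (1 + p) / 2))| ≤ |Real.log (i * τ)| + 2 := by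
    have e : τ * (y + (1 + p) / 2) = (i * τ) * ((y + (1 + p) / 2) / i) := by field_simp
    rw [e, Real.log_mul (by positivity) (by positivity)]
    refine (abs_add_le _ _).trans ?_
    gcongr
    have h1 := Real.log_le_sub_one_of_pos (show 0 < (y + (1 + p) / 2) / i by positivity)
    have h2 := Real.log_le_sub_one_of_pos (show 0 < i / (y + (1 + p) / 2) by positivity)
    rw [← inv_div, Real.log_inv] at h2
    have h3 : (y + (1 + p) / 2) / i ≤ 3 := by
      rw [div_le_iff₀ (by linarith)]; linarith [hy.2]
    have h4 : ((y + (1 + p) / 2) / i)⁻¹ ≤ 2 := by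
      rw [inv_div, div_le_iff₀ (by linarith)]; linarith [hy.1]
    rw [abs_le]
    constructor <;> linarith
  have hexp : |(p - 1) * Real.log (τ * (y + (1 + p) / 2)) -
      (q - 1) * Real.log (τ * (y + (1 + q) / 2))| ≤ |p - q| * (3 * (1 + |Real.log (i * τ)|)) := by
    have e : (p - 1) * Real.log (τ * (y + (1 + p) / 2)) -
        (q - 1) * Real.log (τ * (y + (1 + q) / 2)) =
        (p - q) * Real.log (τ * (y + (1 + p) / 2)) +
        (q - 1) * (Real.log (y + (1 + p) / 2) - Real.log (y + (1 + q) / 2)) := by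
      rw [Real.log_mul hτ.ne' hxp0.ne', Real.log_mul hτ.ne' hxq0.ne']; ring
    have h1 := abs_log_sub_log_le hxp hxq
    have e2 : |y + (1 + p) / 2 - (y + (1 + q) / 2)| = |p - q| / 2 := by
      rw [show y + (1 + p) / 2 - (y + (1 + q) / 2) = (p - q) / 2 by ring, abs_div, abs_two]
    rw [e2] at h1
    have h2 : |q - 1| ≤ 1 := by rw [abs_le]; constructor <;> linarith
    rw [e]
    refine (abs_add_le _ _).trans ?_
    rw [abs_mul, abs_mul]
    have h3 := mul_le_mul_of_nonneg_left hlog (abs_nonneg (p - q))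
    have h4 := mul_le_mul h2 h1 (abs_nonneg _) zero_le_one
    nlinarith [abs_nonneg (p - q), mul_nonneg (abs_nonneg (p - q)) (abs_nonneg (Real.log (i * τ)))]
  have h := abs_rpow_sub_rpow_le (mul_pos hτ hxp0) (mul_pos hτ hxq0) (p - 1) (q - 1)
  refine h.trans ?_
  have h1 := scaledPower_le hτ ⟨hp0, hp1⟩ hi hy
  have h2 := scaledPower_le hτ ⟨hq0, hq1⟩ hi hy
  unfold scaledPower at h1 h2
  calc _ ≤ |p - q| * (3 * (1 + |Real.log (i * τ)|)) *
        (2 * (i * τ) ^ (p - 1) + 2 * (i * τ) ^ (q - 1)) := by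
        apply mul_le_mul hexp (add_le_add h1 h2) (by positivity) (by positivity)
    _ = _ := by ring

/-- The generic weights, as functions of `p`. -/
noncomputable def genericWeight (p : ℝ) (i : ℕ) : ℝ := if i = 0 then shape p 1 else shapeDiff p i

theorem coeffC_eq_genericWeight {p : ℝ} (hp : 0 < p) {m i : ℕ} (h : i < m) :
    coeffC (1 - p) ((1 + p) / 2) m i = genericWeight p i := by
  unfold genericWeight
  split_ifs with hi
  · rw [hi, coeffC_zero hp]
  · exact coeffC_of_lt hp (by lia) h

theorem coeffC_le_genericWeight {p : ℝ} (hp : p ∈ Set.Ioo (0 : ℝ) 1) {m i : ℕ} (h : i ≤ m) :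
    coeffC (1 - p) ((1 + p) / 2) m i ≤ genericWeight p i := by
  unfold genericWeight
  split_ifs with hi
  · rw [hi, coeffC_zero hp.1]
  · exact coeffC_le_shapeDiff hp (by lia) h

/-- A product of three bounded quantities depends on its factors in a Lipschitz manner. -/
theorem abs_mul_mul_sub_le {a a' r r' s s' δ R L : ℝ}
    (ha' : a' ∈ Set.Icc (0 : ℝ) 1) (hs : s ∈ Set.Icc (0 : ℝ) 2) (hr : r ∈ Set.Icc 0 R)
    (hr' : r' ∈ Set.Icc 0 R) (haa : |a - a'| ≤ δ) (hss : |s - s'| ≤ 2 * δ)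
    (hrr : |r - r'| ≤ δ * L) :
    |a * r * s - a' * r' * s'| ≤ δ * (4 * R + 2 * L) := by
  have e : a * r * s - a' * r' * s' =
      (a - a') * (r * s) + a' * s * (r - r') + a' * r' * (s - s') := by
    ring
  have hR : 0 ≤ R := hr.1.trans hr.2
  have hδ : 0 ≤ δ := (abs_nonneg _).trans haa
  have hL : 0 ≤ δ * L := (abs_nonneg _).trans hrr
  have h1 : |(a - a') * (r * s)| ≤ δ * (R * 2) := by
    rw [abs_mul, abs_of_nonneg (mul_nonneg hr.1 hs.1)]
    exact mul_le_mul haa (mul_le_mul hr.2 hs.2 hs.1 hR) (mul_nonneg hr.1 hs.1) hδ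
  have h2 : |a' * s * (r - r')| ≤ 1 * 2 * (δ * L) := by
    rw [abs_mul, abs_of_nonneg (mul_nonneg ha'.1 hs.1)]
    exact mul_le_mul (mul_le_mul ha'.2 hs.2 hs.1 zero_le_one) hrr (abs_nonneg _) (by norm_num)
  have h3 : |a' * r' * (s - s')| ≤ 1 * R * (2 * δ) := by
    rw [abs_mul, abs_of_nonneg (mul_nonneg ha'.1 hr'.1)]
    exact mul_le_mul (mul_le_mul ha'.2 hr'.2 hr'.1 zero_le_one) hss (abs_nonneg _) (by linarith)
  rw [e]
  refine (abs_add_three _ _ _).trans ?_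
  linarith

/-- By the second-difference formula a scaled weight is a product of `p`, the power `scaledPower`, a
factor at most `2`, and the mean-value factor. The first three are Lipschitz in `p`, the power with
a logarithmic loss. The loss is what forces the exponent `(1 + A) / 2` in place of `A`. -/
theorem exists_scaled_genericWeight_bounds {A T : ℝ} (hA : A ∈ Set.Ioo (0 : ℝ) 1) (hT : 0 < T) :
    ∃ C > 0, ∀ τ > 0, ∀ i : ℕ, (max i 1 : ℕ) * τ ≤ T → ∀ p ∈ Set.Ico (1 - A) 1,
      |τ ^ (p - 1) * genericWeight p i| ≤ C * ((max i 1 : ℕ) * τ) ^ (-((1 + A) / 2)) ∧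
      ∀ q ∈ Set.Ico (1 - A) 1,
        |τ ^ (p - 1) * genericWeight p i - τ ^ (q - 1) * genericWeight q i| ≤
          |p - q| * (C * ((max i 1 : ℕ) * τ) ^ (-((1 + A) / 2))) := by
  obtain ⟨C, hC, hlog⟩ := exists_log_mul_rpow_le hA hT
  refine ⟨64 * C, by positivity, fun τ hτ i hi p hp => ?_⟩
  have hmem : ∀ p ∈ Set.Ico (1 - A) 1, p ∈ Set.Ioo (0 : ℝ) 1 := fun p hp =>
    ⟨by linarith [hp.1, hA.2], hp.2⟩
  set j : ℝ := ((max i 1 : ℕ) : ℝ) with hj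
  have hj1 : 1 ≤ j := by rw [hj]; exact_mod_cast le_max_right _ _
  set K := C * (j * τ) ^ (-((1 + A) / 2)) with hK
  have hz : j * τ ∈ Set.Ioc 0 T := ⟨by positivity, hi⟩
  have hlog' : ∀ p ∈ Set.Ico (1 - A) 1, (1 + |Real.log (j * τ)|) * (j * τ) ^ (p - 1) ≤ K :=
    fun p hp => hlog _ hz (p - 1) ⟨by linarith [hp.1], by linarith [hp.2]⟩
  have hpow : ∀ p ∈ Set.Ico (1 - A) 1, (j * τ) ^ (p - 1) ≤ K := fun p hp => by
    have := hlog' p hp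
    have h2 : 0 ≤ |Real.log (j * τ)| * (j * τ) ^ (p - 1) := by positivity
    linarith
  have hK0 : 0 ≤ K := by positivity
  have hR : ∀ p ∈ Set.Ico (1 - A) 1, ∀ y ∈ Set.Icc (j - 1) (j + 1),
      scaledPower τ p y ∈ Set.Icc 0 (2 * K) := fun p hp y hy =>
    ⟨scaledPower_nonneg hτ (hmem p hp).1 (by linarith [hy.1]),
      (scaledPower_le hτ (hmem p hp) hj1 hy).trans (by linarith [hpow p hp])⟩
  have hRR : ∀ p ∈ Set.Ico (1 - A) 1, ∀ q ∈ Set.Ico (1 - A) 1, ∀ y ∈ Set.Icc (j - 1) (j + 1),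
      |scaledPower τ p y - scaledPower τ q y| ≤ |p - q| * (12 * K) := fun p hp q hq y hy => by
    refine (abs_scaledPower_sub_le hτ (hmem p hp) (hmem q hq) hj1 hy).trans ?_
    apply mul_le_mul_of_nonneg_left _ (abs_nonneg _)
    linarith [hlog' p hp, hlog' q hq]
  -- The zeroth weight is a value of `shape` and not a second difference, but it factors in the same
  -- way, with `1` in place of `p`. It is estimated at lag one, which is why `max i 1` appears.
  rcases Nat.eq_zero_or_pos i with h0 | h0
  · have hj' : j = 1 := by rw [hj, h0]; simp
    have e : ∀ p ∈ Set.Ico (1 - A) 1,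
        τ ^ (p - 1) * genericWeight p i = 1 * scaledPower τ p 1 * (1 / 2 + 1 / (1 + p)) := by
      intro p hp
      have hp0 := (hmem p hp).1
      rw [scaledPower_eq hτ hp0 zero_le_one, genericWeight, if_pos h0, shape]
      have e1 : (1 + (1 + p) / 2) ^ p = (1 + (1 + p) / 2) ^ (p - 1) * (1 + (1 + p) / 2) := by
        rw [← Real.rpow_add_one (by positivity)]; ring_nf
      rw [e1]
      field_simp
      ring
    have hs : ∀ p ∈ Set.Ico (1 - A) 1, 1 / 2 + 1 / (1 + p) ∈ Set.Icc (0 : ℝ) 2 := by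
      intro p hp
      have hp0 := (hmem p hp).1
      have : 1 / (1 + p) ≤ 1 := by rw [div_le_one (by linarith)]; linarith
      exact ⟨by positivity, by linarith⟩
    have hy : (1 : ℝ) ∈ Set.Icc (j - 1) (j + 1) := by rw [hj']; norm_num
    refine ⟨?_, fun q hq => ?_⟩
    · rw [e p hp, abs_of_nonneg (mul_nonneg (by simpa using (hR p hp 1 hy).1) (hs p hp).1), one_mul]
      refine (mul_le_mul (hR p hp 1 hy).2 (hs p hp).2 (hs p hp).1 (by positivity)).trans ?_
      linarith
    · rw [e p hp, e q hq]
      refine (abs_mul_mul_sub_le (δ := |p - q|) (by simp) (hs p hp) (hR p hp 1 hy)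
        (hR q hq 1 hy) (by simp) ?_ (hRR p hp q hq 1 hy)).trans ?_
      · have hp0 := (hmem p hp).1
        have hq0 := (hmem q hq).1
        rw [add_sub_add_left_eq_sub, div_sub_div _ _ (by linarith) (by linarith), abs_div,
          div_le_iff₀ (by positivity), abs_of_pos (show 0 < (1 + p) * (1 + q) by positivity),
          show 1 * (1 + q) - (1 + p) * 1 = -(p - q) by ring, abs_neg]
        nlinarith [abs_nonneg (p - q), mul_pos hp0 hq0]
      · apply mul_le_mul_of_nonneg_left _ (abs_nonneg _); linarith
  · have hj' : j = i := by rw [hj, max_eq_left (by lia)]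
    have hne : i ≠ 0 := by lia
    have e : ∀ p ∈ Set.Ico (1 - A) 1, ∀ y ∈ Set.Icc (j - 1) (j + 1),
        τ ^ (p - 1) * shapeDeriv₂ p y =
          p * scaledPower τ p y * (1 + (1 - p) / (2 * y + 1 + p)) := by
      intro p hp y hy
      rw [scaledPower_eq hτ (hmem p hp).1 (by linarith [hy.1]), shapeDeriv₂]
      ring
    have hs : ∀ p ∈ Set.Ico (1 - A) 1, ∀ y ∈ Set.Icc (j - 1) (j + 1),
        1 + (1 - p) / (2 * y + 1 + p) ∈ Set.Icc (0 : ℝ) 2 := by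
      intro p hp y hy
      have hp0 := (hmem p hp).1
      have hp1 := (hmem p hp).2
      have hD : 1 ≤ 2 * y + 1 + p := by linarith [hy.1]
      have h1 : (1 - p) / (2 * y + 1 + p) ≤ 1 := by rw [div_le_one (by linarith)]; linarith
      have h2 : 0 ≤ (1 - p) / (2 * y + 1 + p) := div_nonneg (by linarith) (by linarith)
      exact ⟨by linarith, by linarith⟩
    refine ⟨?_, fun q hq => ?_⟩
    · obtain ⟨η, hη, s, hs', e1⟩ := exists_shapeDiff_eq (hmem p hp) hj1
      have hp' := hmem p hp
      rw [genericWeight, if_neg hne, ← hj', e1, mul_left_comm, e p hp η hη,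
        abs_of_nonneg (mul_nonneg hs'.1.le (mul_nonneg (mul_nonneg hp'.1.le (hR p hp η hη).1)
          (hs p hp η hη).1))]
      have h1 : p * scaledPower τ p η ≤ 1 * (2 * K) :=
        mul_le_mul hp'.2.le (hR p hp η hη).2 (hR p hp η hη).1 zero_le_one
      have h2 := mul_le_mul h1 (hs p hp η hη).2 (hs p hp η hη).1 (by linarith)
      have h3 := mul_le_mul hs'.2.le h2 (mul_nonneg (mul_nonneg hp'.1.le (hR p hp η hη).1)
          (hs p hp η hη).1) (by norm_num)
      linarith
    -- The mean-value formula is applied to the difference of the two scaled functions, not to each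
    -- separately, so that both second derivatives are taken at the same `η` with the same factor
    -- `s`.
    · have hd : ∀ y ∈ Set.Icc (j - 1) (j + 1), HasDerivAt
          (fun y => τ ^ (p - 1) * shape p y - τ ^ (q - 1) * shape q y)
          (τ ^ (p - 1) * shapeDeriv p y - τ ^ (q - 1) * shapeDeriv q y) y := fun y hy =>
        ((hasDerivAt_shape (hmem p hp).1 (by linarith [hy.1])).const_mul _).sub
          ((hasDerivAt_shape (hmem q hq).1 (by linarith [hy.1])).const_mul _)
      have hd' : ∀ y ∈ Set.Icc (j - 1) (j + 1), HasDerivAt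
          (fun y => τ ^ (p - 1) * shapeDeriv p y - τ ^ (q - 1) * shapeDeriv q y)
          (τ ^ (p - 1) * shapeDeriv₂ p y - τ ^ (q - 1) * shapeDeriv₂ q y) y := fun y hy =>
        ((hasDerivAt_shapeDeriv (hmem p hp).1 (by linarith [hy.1])).const_mul _).sub
          ((hasDerivAt_shapeDeriv (hmem q hq).1 (by linarith [hy.1])).const_mul _)
      obtain ⟨η, hη, s, hs', e1⟩ := exists_second_difference_eq (f'' := fun y =>
        τ ^ (p - 1) * shapeDeriv₂ p y - τ ^ (q - 1) * shapeDeriv₂ q y) hd hd'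
      have e2 : τ ^ (p - 1) * genericWeight p i - τ ^ (q - 1) * genericWeight q i
          = s * (τ ^ (p - 1) * shapeDeriv₂ p η - τ ^ (q - 1) * shapeDeriv₂ q η) := by
        rw [← e1, genericWeight, genericWeight, if_neg hne, if_neg hne, ← hj', shapeDiff, shapeDiff]
        ring
      have hp' := hmem p hp
      have hq' := hmem q hq
      have h := abs_mul_mul_sub_le (δ := |p - q|)
        (Set.Ioo_subset_Icc_self hq') (hs p hp η hη) (hR p hp η hη) (hR q hq η hη) le_rfl
        (s' := 1 + (1 - q) / (2 * η + 1 + q)) (by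
          have hDp : 1 ≤ 2 * η + 1 + p := by linarith [hη.1, hp'.1]
          have hDq : 1 ≤ 2 * η + 1 + q := by linarith [hη.1, hq'.1]
          rw [add_sub_add_left_eq_sub, div_sub_div _ _ (by linarith) (by linarith), abs_div,
            div_le_iff₀ (by positivity), abs_of_pos (show 0 < (2 * η + 1 + p) * (2 * η + 1 + q)
            from mul_pos (by linarith) (by linarith)),
            show (1 - p) * (2 * η + 1 + q) - (2 * η + 1 + p) * (1 - q) = (2 * η + 2) * -(p - q)
              by ring, abs_mul, abs_neg, abs_of_nonneg (show 0 ≤ 2 * η + 2 by linarith [hη.1])]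
          have h1 : 2 * η + 2 ≤ 2 * ((2 * η + 1 + p) * (2 * η + 1 + q)) := by
            nlinarith [hη.1, hp'.1, hq'.1]
          nlinarith [abs_nonneg (p - q)]) (hRR p hp q hq η hη)
      rw [e2, e p hp η hη, e q hq η hη, abs_mul, abs_of_pos hs'.1]
      refine (mul_le_mul hs'.2.le h (abs_nonneg _) (by norm_num)).trans ?_
      have h3 : 0 ≤ |p - q| * K := by positivity
      nlinarith

/-- Convexity traps every slope on `[1, 2]` between a chord from `1/2` and a chord to `3`. The
values `Γ(1/2) = √π ≤ 2` and `Γ(3) = 2` give the constant `4`. -/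
theorem abs_Gamma_sub_Gamma_le {x y : ℝ} (hx : x ∈ Set.Icc (1 : ℝ) 2) (hy : y ∈ Set.Icc (1 : ℝ) 2) :
    |Real.Gamma x - Real.Gamma y| ≤ 4 * |x - y| := by
  wlog hxy : x < y generalizing x y
  · rcases (not_lt.1 hxy).eq_or_lt with rfl | h
    · simp
    · rw [abs_sub_comm, abs_sub_comm x]; exact this hy hx h
  have hpos : ∀ z : ℝ, 0 < z → 0 ≤ Real.Gamma z := fun z hz => (Real.Gamma_pos_of_pos hz).le
  have hG3 : Real.Gamma 3 = 2 := by
    rw [show (3 : ℝ) = (2 : ℕ) + 1 by norm_num, Real.Gamma_nat_eq_factorial]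
    norm_num
  have hGh : Real.Gamma (1 / 2) ≤ 2 := by
    rw [Real.Gamma_one_half_eq]
    rw [show (2 : ℝ) = √4 by rw [show (4 : ℝ) = 2 ^ 2 by norm_num]; simp]
    exact Real.sqrt_le_sqrt Real.pi_le_four
  have h1 := Real.convexOn_Gamma.slope_mono_adjacent (x := x) (y := y) (z := 3)
    (show (0 : ℝ) < x by linarith [hx.1]) (show (0 : ℝ) < 3 by norm_num) hxy (by linarith [hy.2])
  have h2 := Real.convexOn_Gamma.slope_mono_adjacent (x := 1 / 2) (y := x) (z := y)
    (show (0 : ℝ) < 1 / 2 by norm_num) (show (0 : ℝ) < y by linarith [hy.1]) (by linarith [hx.1])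
    hxy
  have h3 : (Real.Gamma 3 - Real.Gamma y) / (3 - y) ≤ 4 := by
    rw [div_le_iff₀ (by linarith [hy.2])]
    linarith [hpos y (by linarith [hy.1]), hy.2]
  have h4 : -4 ≤ (Real.Gamma x - Real.Gamma (1 / 2)) / (x - 1 / 2) := by
    rw [le_div_iff₀ (by linarith [hx.1])]
    linarith [hpos x (by linarith [hx.1]), hx.1]
  have h5 := h1.trans h3
  have h6 := h4.trans h2
  rw [div_le_iff₀ (by linarith)] at h5
  rw [le_div_iff₀ (by linarith)] at h6
  rw [abs_sub_comm x, abs_of_pos (show 0 < y - x by linarith), abs_le]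
  constructor <;> linarith

theorem exists_le_Gamma : ∃ c > 0, ∀ x ∈ Set.Icc (1 : ℝ) 2, c ≤ Real.Gamma x := by
  have hc : ContinuousOn Real.Gamma (Set.Icc (1 : ℝ) 2) := fun x hx =>
    (Real.differentiableAt_Gamma (fun m => by
      have : (0 : ℝ) ≤ m := Nat.cast_nonneg m
      linarith [hx.1])).continuousAt.continuousWithinAt
  obtain ⟨x, hx, h⟩ := isCompact_Icc.exists_isMinOn (Set.nonempty_Icc.2 (by norm_num)) hc
  exact ⟨_, Real.Gamma_pos_of_pos (by linarith [hx.1]), fun y hy => h hy⟩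

/-- The weights `a_i^{(m)}` as functions of `p = 1 - a = 2σ - 1`. -/
noncomputable def nodeWeight (τ p : ℝ) (m i : ℕ) : ℝ :=
  coeffC (1 - p) ((1 + p) / 2) m i / (τ ^ (1 - p) * Real.Gamma (1 + p))

/-- The weakly singular discrete kernel, up to the factor `τ`. -/
noncomputable def singularKernel (τ b : ℝ) (i : ℕ) : ℝ := ((max i 1 : ℕ) * τ) ^ (-b)

theorem nodeWeight_eq {τ p : ℝ} (hτ : 0 < τ) (m i : ℕ) :
    nodeWeight τ p m i =
      τ ^ (p - 1) * coeffC (1 - p) ((1 + p) / 2) m i * (Real.Gamma (1 + p))⁻¹ := by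
  rw [nodeWeight, show p - 1 = -(1 - p) by ring, Real.rpow_neg hτ.le]
  field_simp

theorem nodeWeight_nonneg {τ p : ℝ} (hτ : 0 < τ) (hp : p ∈ Set.Ioo (0 : ℝ) 1) {m i : ℕ}
    (h1 : 1 ≤ m) (h : i ≤ m) : 0 ≤ nodeWeight τ p m i :=
  div_nonneg (coeffC_nonneg hp h1 h)
    (mul_nonneg (Real.rpow_nonneg hτ.le _) (Real.Gamma_pos_of_pos (by linarith [hp.1])).le)

theorem nodeWeight_succ_le {τ p : ℝ} (hτ : 0 < τ) (hp : p ∈ Set.Ioo (0 : ℝ) 1) {m i : ℕ}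
    (h : i < m) : nodeWeight τ p m (i + 1) ≤ nodeWeight τ p m i :=
  div_le_div_of_nonneg_right (coeffC_succ_le hp h)
    (mul_nonneg (Real.rpow_nonneg hτ.le _) (Real.Gamma_pos_of_pos (by linarith [hp.1])).le)

theorem nodeWeight_one_le {τ p : ℝ} (hτ : 0 < τ) (hp : p ∈ Set.Ioo (0 : ℝ) 1) {m : ℕ}
    (h : 1 ≤ m) : ((1 + p) / 2) ^ 2 * nodeWeight τ p m 1 ≤ p * nodeWeight τ p m 0 := by
  unfold nodeWeight
  rw [← mul_div_assoc, ← mul_div_assoc]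
  exact div_le_div_of_nonneg_right (coeffC_one_le hp h)
    (mul_nonneg (Real.rpow_nonneg hτ.le _) (Real.Gamma_pos_of_pos (by linarith [hp.1])).le)

/-- Weights at different levels are compared only for `i` below both `m` and `n`, where both are
generic. The last weight has another form, and the energy argument never compares it across levels.
-/
theorem exists_nodeWeight_bounds {A T : ℝ} (hA : A ∈ Set.Ioo (0 : ℝ) 1) (hT : 0 < T) :
    ∃ C > 0, ∀ τ > 0, ∀ i : ℕ, (max i 1 : ℕ) * τ ≤ T → ∀ p ∈ Set.Ico (1 - A) 1, ∀ m, 1 ≤ m →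
      (i ≤ m → nodeWeight τ p m i ≤ C * singularKernel τ ((1 + A) / 2) i) ∧
      ∀ q ∈ Set.Ico (1 - A) 1, ∀ n, i < m → i < n →
        |nodeWeight τ p m i - nodeWeight τ q n i| ≤
          C * |p - q| * singularKernel τ ((1 + A) / 2) i := by
  obtain ⟨C, hC, hb⟩ := exists_scaled_genericWeight_bounds hA hT
  obtain ⟨c, hc, hΓ⟩ := exists_le_Gamma
  refine ⟨C * c⁻¹ + C * (4 * c⁻¹ ^ 2), by positivity, fun τ hτ i hi p hp m hm => ?_⟩
  have hmem : ∀ p ∈ Set.Ico (1 - A) 1, p ∈ Set.Ioo (0 : ℝ) 1 := fun p hp =>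
    ⟨by linarith [hp.1, hA.2], hp.2⟩
  have hinv : ∀ p ∈ Set.Ico (1 - A) 1, (Real.Gamma (1 + p))⁻¹ ∈ Set.Icc 0 c⁻¹ := fun p hp => by
    have h := hΓ (1 + p) ⟨by linarith [(hmem p hp).1], by linarith [hp.2]⟩
    exact ⟨inv_nonneg.2 (hc.le.trans h), inv_anti₀ hc h⟩
  have hK : 0 ≤ singularKernel τ ((1 + A) / 2) i := by unfold singularKernel; positivity
  obtain ⟨h1, h2⟩ := hb τ hτ i hi p hp
  rw [← singularKernel] at h1 h2
  constructor
  · intro him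
    rw [nodeWeight_eq hτ]
    have h3 : τ ^ (p - 1) * coeffC (1 - p) ((1 + p) / 2) m i ≤
        C * singularKernel τ ((1 + A) / 2) i :=
      (mul_le_mul_of_nonneg_left (coeffC_le_genericWeight (hmem p hp) him) (by positivity)).trans
        ((le_abs_self _).trans h1)
    refine (mul_le_mul h3 (hinv p hp).2 (hinv p hp).1 (by positivity)).trans ?_
    have : 0 ≤ C * (4 * c⁻¹ ^ 2) * singularKernel τ ((1 + A) / 2) i := by positivity
    linarith
  · intro q hq n him hin
    have h3 := h2 q hq
    obtain ⟨h4, -⟩ := hb τ hτ i hi q hq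
    rw [← singularKernel] at h4
    rw [nodeWeight_eq hτ, nodeWeight_eq hτ, coeffC_eq_genericWeight (hmem p hp).1 him,
      coeffC_eq_genericWeight (hmem q hq).1 hin]
    set X := τ ^ (p - 1) * genericWeight p i
    set Y := τ ^ (q - 1) * genericWeight q i
    have h5 : |(Real.Gamma (1 + p))⁻¹ - (Real.Gamma (1 + q))⁻¹| ≤ 4 * c⁻¹ ^ 2 * |p - q| := by
      have hp1 : 0 < Real.Gamma (1 + p) := Real.Gamma_pos_of_pos (by linarith [(hmem p hp).1])
      have hq1 : 0 < Real.Gamma (1 + q) := Real.Gamma_pos_of_pos (by linarith [(hmem q hq).1])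
      have e : (Real.Gamma (1 + p))⁻¹ - (Real.Gamma (1 + q))⁻¹ =
          (Real.Gamma (1 + q) - Real.Gamma (1 + p)) *
            ((Real.Gamma (1 + p))⁻¹ * (Real.Gamma (1 + q))⁻¹) := by field_simp
      have h6 := abs_Gamma_sub_Gamma_le (x := 1 + q) (y := 1 + p)
        ⟨by linarith [(hmem q hq).1], by linarith [hq.2]⟩
        ⟨by linarith [(hmem p hp).1], by linarith [hp.2]⟩
      rw [add_sub_add_left_eq_sub, abs_sub_comm q p] at h6
      rw [e, abs_mul, abs_of_nonneg (mul_nonneg (hinv p hp).1 (hinv q hq).1)]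
      refine (mul_le_mul h6 (mul_le_mul (hinv p hp).2 (hinv q hq).2 (hinv q hq).1
        (by positivity)) (mul_nonneg (hinv p hp).1 (hinv q hq).1) (by positivity)).trans ?_
      apply le_of_eq; ring
    have e : X * (Real.Gamma (1 + p))⁻¹ - Y * (Real.Gamma (1 + q))⁻¹ =
        (X - Y) * (Real.Gamma (1 + p))⁻¹ +
          Y * ((Real.Gamma (1 + p))⁻¹ - (Real.Gamma (1 + q))⁻¹) := by
      ring
    rw [e]
    refine (abs_add_le _ _).trans ?_
    rw [abs_mul, abs_mul, abs_of_nonneg (hinv p hp).1]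
    refine (add_le_add (mul_le_mul h3 (hinv p hp).2 (hinv p hp).1 (by positivity))
      (mul_le_mul h4 h5 (abs_nonneg _) (by positivity))).trans ?_
    apply le_of_eq; ring

/-- Integral comparison in telescoped form: by concavity of `z ↦ z ^ (1 - b)`, the term `(n + 1) ^
(-b)` is at most the increment of `z ^ (1 - b) / (1 - b)` over `[n, n + 1]`. The term `i = 0`
accounts for the extra `1`. -/
theorem sum_singularKernel_le {τ b T : ℝ} (hτ : 0 < τ) (hb : b ∈ Set.Ioo (0 : ℝ) 1) (N : ℕ)
    (hN : (max N 1 : ℕ) * τ ≤ T) :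
    τ * ∑ i ∈ Finset.range (N + 1), singularKernel τ b i ≤ (1 + T) * (1 + 1 / (1 - b)) := by
  have hb1 : 0 < 1 - b := by linarith [hb.2]
  have hb' : 1 - b ∈ Set.Ioo (0 : ℝ) 1 := ⟨hb1, by linarith [hb.1]⟩
  have hT : 0 < T := lt_of_lt_of_le (by positivity) hN
  have hle : ∀ z : ℝ, 0 ≤ z → z ≤ T → z ^ (1 - b) ≤ 1 + T := fun z hz hzT => by
    calc z ^ (1 - b) ≤ (1 + T) ^ (1 - b) := Real.rpow_le_rpow hz (by linarith) hb1.le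
      _ ≤ (1 + T) ^ (1 : ℝ) := Real.rpow_le_rpow_of_exponent_le (by linarith) hb'.2.le
      _ = 1 + T := Real.rpow_one _
  have hsum : ∀ N : ℕ, ∑ i ∈ Finset.range (N + 1), singularKernel τ b i ≤
      τ ^ (-b) * (1 + (N : ℝ) ^ (1 - b) / (1 - b)) := by
    intro N
    induction N with
    | zero => simp [singularKernel, Real.zero_rpow hb1.ne']
    | succ n ih =>
      rw [Finset.sum_range_succ]
      refine (add_le_add_left ih _).trans ?_
      have hn : (0 : ℝ) < (n : ℝ) + 1 := by positivity
      have h := rpow_le_tangent hb' hn (Nat.cast_nonneg n)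
      have e : ((n : ℝ) + 1) ^ (1 - b) = ((n : ℝ) + 1) ^ (-b) * ((n : ℝ) + 1) := by
        rw [← Real.rpow_add_one hn.ne']; ring_nf
      have h2 : (n : ℝ) ^ (1 - b) ≤ ((n : ℝ) + 1) ^ (1 - b) - (1 - b) * ((n : ℝ) + 1) ^ (-b) := by
        refine h.trans (le_of_eq ?_)
        rw [e]; field_simp; ring
      have h3 : singularKernel τ b (n + 1) = τ ^ (-b) * ((n : ℝ) + 1) ^ (-b) := by
        rw [singularKernel, max_eq_left (by lia), Real.mul_rpow (by positivity) hτ.le]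
        push_cast; ring
      rw [h3, ← mul_add]
      apply mul_le_mul_of_nonneg_left _ (by positivity)
      have h4 : (n : ℝ) ^ (1 - b) / (1 - b) ≤
          ((n : ℝ) + 1) ^ (1 - b) / (1 - b) - ((n : ℝ) + 1) ^ (-b) := by
        refine (div_le_div_of_nonneg_right h2 hb1.le).trans (le_of_eq ?_)
        field_simp
      push_cast
      linarith
  have e : τ * τ ^ (-b) = τ ^ (1 - b) := by
    rw [mul_comm, ← Real.rpow_add_one hτ.ne']; ring_nf
  have hτT : τ ≤ T := le_trans (by
    have : (1 : ℝ) ≤ (max N 1 : ℕ) := by exact_mod_cast le_max_right _ _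
    nlinarith) hN
  have hNT : N * τ ≤ T := le_trans (by gcongr; exact le_max_left _ _) hN
  calc τ * ∑ i ∈ Finset.range (N + 1), singularKernel τ b i
      ≤ τ * (τ ^ (-b) * (1 + (N : ℝ) ^ (1 - b) / (1 - b))) := by gcongr; exact hsum N
    _ = τ ^ (1 - b) + (N * τ) ^ (1 - b) / (1 - b) := by
      rw [Real.mul_rpow (Nat.cast_nonneg N) hτ.le, ← mul_assoc, e]; ring
    _ ≤ (1 + T) + (1 + T) / (1 - b) := by
      gcongr
      · exact hle _ hτ.le hτT
      · exact hle _ (by positivity) hNT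
    _ = _ := by ring

/-! ### Stability of the time discretization -/

section Stability

variable {Z : Type*} [AddCommGroup Z] [Module ℝ Z]

theorem bilin_le_of_nonneg {Q : LinearMap.BilinForm ℝ Z} (hs : ∀ x y, Q x y = Q y x)
    (h0 : ∀ x, 0 ≤ Q x x) (x y : Z) : |Q x y| ≤ (Q x x + Q y y) / 2 := by
  have h1 := h0 (x + y)
  have h2 := h0 (x - y)
  simp only [map_add, map_sub, LinearMap.add_apply, LinearMap.sub_apply] at h1 h2
  rw [hs y x] at h1 h2
  rw [abs_le]
  constructor <;> linarith

/-- The energy of two consecutive time levels. -/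
noncomputable def pairEnergy (Q : LinearMap.BilinForm ℝ Z) (p : ℝ) (a b : Z) : ℝ :=
  Q a a + p * Q a (a - b) + p * (p + 1) / 4 * Q (a - b) (a - b)

/-- Completing the square: `(p + 1) * pairEnergy Q p a b` equals `Q a a` plus `p / 4` times the
value of `Q` at `(p + 1) (a - b) + 2 a`. Then `p + 1 < 2` gives the factor `1/2`. -/
theorem half_le_pairEnergy {Q : LinearMap.BilinForm ℝ Z} (hs : ∀ x y, Q x y = Q y x)
    (h0 : ∀ x, 0 ≤ Q x x) {p : ℝ} (hp : p ∈ Set.Ioo (0 : ℝ) 1) (a b : Z) :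
    Q a a / 2 ≤ pairEnergy Q p a b := by
  have h := h0 ((p + 1) • (a - b) + (2 : ℝ) • a)
  have ha := h0 a
  have e : Q ((p + 1) • (a - b) + (2 : ℝ) • a) ((p + 1) • (a - b) + (2 : ℝ) • a) =
      (p + 1) ^ 2 * Q (a - b) (a - b) + 4 * (p + 1) * Q a (a - b) + 4 * Q a a := by
    generalize a - b = x
    simp only [map_add, map_smul, LinearMap.add_apply, LinearMap.smul_apply, smul_eq_mul, hs x a]
    ring
  rw [e] at h
  have h1 : Q a a ≤ (p + 1) * pairEnergy Q p a b := by
    have := mul_nonneg hp.1.le h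
    unfold pairEnergy
    nlinarith
  have h2 : 0 ≤ pairEnergy Q p a b :=
    nonneg_of_mul_nonneg_right (ha.trans h1) (by linarith [hp.1])
  nlinarith [hp.2]

/-- This is the price of changing `p` between steps, needed because the order of the derivative
varies in time. -/
theorem pairEnergy_le {Q : LinearMap.BilinForm ℝ Z} (hs : ∀ x y, Q x y = Q y x)
    (h0 : ∀ x, 0 ≤ Q x x) {p q : ℝ} (hp : p ∈ Set.Icc (0 : ℝ) 1) (hq : q ∈ Set.Icc (0 : ℝ) 1)
    (a b : Z) : pairEnergy Q p a b ≤ pairEnergy Q q a b + |p - q| * (4 * (Q a a + Q b b)) := by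
  have hx : Q (a - b) (a - b) ≤ 2 * (Q a a + Q b b) := by
    have h1 := h0 (a + b)
    simp only [map_add, map_sub, LinearMap.add_apply, LinearMap.sub_apply] at h1 ⊢
    linarith
  have hx0 := h0 (a - b)
  have hax := bilin_le_of_nonneg hs h0 a (a - b)
  have e : pairEnergy Q p a b = pairEnergy Q q a b +
      (p - q) * (Q a (a - b) + (p + q + 1) / 4 * Q (a - b) (a - b)) := by
    unfold pairEnergy; ring
  have hb : |Q a (a - b) + (p + q + 1) / 4 * Q (a - b) (a - b)| ≤ 4 * (Q a a + Q b b) := by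
    have h1 : 0 ≤ (p + q + 1) / 4 * Q (a - b) (a - b) :=
      mul_nonneg (by linarith [hp.1, hq.1]) hx0
    have h2 : (p + q + 1) / 4 * Q (a - b) (a - b) ≤ 3 / 4 * Q (a - b) (a - b) :=
      mul_le_mul_of_nonneg_right (by linarith [hp.2, hq.2]) hx0
    have ha := h0 a
    have hb := h0 b
    rw [abs_le] at hax ⊢
    constructor <;> linarith [hax.1, hax.2]
  rw [e]
  refine add_le_add le_rfl ((le_abs_self _).trans ?_)
  rw [abs_mul]
  gcongr

/-- The two sides differ by `p (p + 1) / 4` times the value of `Q` at the second difference of `w`.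
The energy is chosen so that the remainder is this square. -/
theorem pairEnergy_sub_le {Q : LinearMap.BilinForm ℝ Z} (hs : ∀ x y, Q x y = Q y x)
    (h0 : ∀ x, 0 ≤ Q x x) {p τ : ℝ} (hp : 0 ≤ p) (hτ : 0 < τ) (w : ℕ → Z) (n : ℕ) :
    pairEnergy Q p (w (n + 2)) (w (n + 1)) - pairEnergy Q p (w (n + 1)) (w n) ≤
      2 * τ * Q (average ((1 + p) / 2) w (n + 1)) (timeDiff τ ((1 + p) / 2) w (n + 1)) := by
  simp only [average, timeDiff, Nat.add_sub_cancel]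
  rw [show n + 1 + 1 = n + 2 by ring]
  generalize w (n + 2) = a
  generalize w (n + 1) = b
  generalize w n = c
  have h := mul_nonneg (mul_nonneg hp (by linarith : 0 ≤ p + 1)) (h0 (a - b - (b - c)))
  rw [map_smul, smul_eq_mul, ← mul_assoc, mul_inv_cancel₀ (by positivity), one_mul]
  simp only [pairEnergy, map_add, map_sub, LinearMap.add_apply, LinearMap.sub_apply, map_smul,
    LinearMap.smul_apply, smul_eq_mul, hs b a, hs c a, hs c b] at h ⊢
  linarith

theorem bilin_average_le {B : LinearMap.BilinForm ℝ Z} (h0 : ∀ x, 0 ≤ B x x) {σ : ℝ}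
    (hσ : σ ∈ Set.Icc (0 : ℝ) 1) (w : ℕ → Z) (m : ℕ) :
    B (average σ w m) (average σ w m) ≤ B (w (m + 1)) (w (m + 1)) + B (w m) (w m) := by
  have h := mul_nonneg (mul_nonneg hσ.1 (sub_nonneg.2 hσ.2)) (h0 (w (m + 1) - w m))
  have h1 := mul_nonneg (sub_nonneg.2 hσ.2) (h0 (w (m + 1)))
  have h2 := mul_nonneg hσ.1 (h0 (w m))
  simp only [average, map_add, map_sub, LinearMap.add_apply, LinearMap.sub_apply, map_smul,
    LinearMap.smul_apply, smul_eq_mul] at h ⊢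
  linarith

/-- Alikhanov's inequality for the discrete fractional derivative. -/
theorem half_sum_le_bilin_average {B : LinearMap.BilinForm ℝ Z} (hs : ∀ x y, B x y = B y x)
    (h0 : ∀ x, 0 ≤ B x x) {p : ℝ} {m : ℕ} (hm : 1 ≤ m) {a : ℕ → ℝ}
    (ha0 : 0 ≤ a m) (ha : ∀ i < m, a (i + 1) ≤ a i)
    (ha1 : ((1 + p) / 2) ^ 2 * a 1 ≤ p * a 0) (w : ℕ → Z) :
    (∑ i ∈ Finset.range (m + 1), a (m - i) * (B (w (i + 1)) (w (i + 1)) - B (w i) (w i))) / 2 ≤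
      B (average ((1 + p) / 2) w m)
        (∑ i ∈ Finset.range (m + 1), a (m - i) • (w (i + 1) - w i)) := by
  set x := average ((1 + p) / 2) w m with hx
  set r : ℕ → ℝ := fun i => B (x - w i) (x - w i) with hr
  -- Abel summation for the squared distances `r i` from the average `x`: the weights `a (m - i)`
  -- increase with `i`, so every interior term has the right sign. The condition on `a 0` and `a 1`
  -- settles the last one, because `r m = σ² d`, `r (m + 1) = (1 - σ)² d` and `σ² - (1 - σ)² = p`.
  have key : ∀ n < m, -(a (m - n) * r (n + 1)) ≤
      ∑ i ∈ Finset.range (n + 1), a (m - i) * (r i - r (i + 1)) := by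
    intro n
    induction n with
    | zero =>
      intro _
      have := mul_nonneg ha0 (h0 (x - w 0))
      simp only [zero_add, Finset.sum_range_one, Nat.sub_zero]
      linarith
    | succ n ih =>
      intro hn
      rw [Finset.sum_range_succ]
      have h1 := ih (by lia)
      have h2 := ha (m - (n + 1)) (by lia)
      rw [show m - (n + 1) + 1 = m - n by lia] at h2
      have h3 := mul_le_mul_of_nonneg_right h2 (h0 (x - w (n + 1)))
      simp only [hr] at h1 ⊢
      linarith
  have h1 := key (m - 1) (by lia)
  rw [show m - 1 + 1 = m by lia, show m - (m - 1) = 1 by lia] at h1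
  set d := B (w (m + 1) - w m) (w (m + 1) - w m) with hd
  have e1 : r m = ((1 + p) / 2) ^ 2 * d := by
    have : x - w m = ((1 + p) / 2) • (w (m + 1) - w m) := by rw [hx, average]; module
    simp only [hr, this, map_smul, LinearMap.smul_apply, smul_eq_mul, hd]
    ring
  have e2 : r (m + 1) = ((1 - p) / 2) ^ 2 * d := by
    have : x - w (m + 1) = (-((1 - p) / 2)) • (w (m + 1) - w m) := by rw [hx, average]; module
    simp only [hr, this, map_smul, LinearMap.smul_apply, smul_eq_mul, hd]
    ring
  have h2 : 0 ≤ ∑ i ∈ Finset.range (m + 1), a (m - i) * (r i - r (i + 1)) := by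
    rw [Finset.sum_range_succ, Nat.sub_self, e2]
    rw [e1] at h1 ⊢
    have h3 := mul_nonneg (sub_nonneg.2 ha1) (h0 (w (m + 1) - w m))
    rw [← hd] at h3
    linarith
  -- Polarization: `r i - r (i + 1) = 2 B (x, w (i + 1) - w i) - (B (w (i + 1), w (i + 1)) - B (w i,
  -- w i))`.
  have e3 : ∑ i ∈ Finset.range (m + 1), a (m - i) * (r i - r (i + 1)) =
      2 * B x (∑ i ∈ Finset.range (m + 1), a (m - i) • (w (i + 1) - w i)) -
        ∑ i ∈ Finset.range (m + 1), a (m - i) * (B (w (i + 1)) (w (i + 1)) - B (w i) (w i)) := by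
    rw [map_sum, Finset.mul_sum, ← Finset.sum_sub_distrib]
    refine Finset.sum_congr rfl fun i _ => ?_
    simp only [hr, map_sub, map_smul, LinearMap.sub_apply, smul_eq_mul, hs (w i) x,
      hs (w (i + 1)) x]
    ring
  linarith

end Stability

/-- The memory part of the energy. -/
noncomputable def memoryEnergy (a : ℕ → ℕ → ℝ) (V : ℕ → ℝ) (m : ℕ) : ℝ :=
  ∑ i ∈ Finset.range m, a m i * V (m + 1 - i)

/-- Regrouping by lag turns the convolution with increments into a difference of two memory sums
with the same weights. The memory sums stop at `V 2`, so the exceptional last weight meets only `V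
0` and `V 1`, which count as data. -/
theorem sum_weight_mul_sub_eq (a : ℕ → ℝ) (V : ℕ → ℝ) (n : ℕ) :
    ∑ i ∈ Finset.range (n + 2), a (n + 1 - i) * (V (i + 1) - V i) =
      ∑ i ∈ Finset.range (n + 1), a i * V (n + 2 - i) - ∑ i ∈ Finset.range n, a i * V (n + 1 - i) +
        (a (n + 1) - a n) * V 1 - a (n + 1) * V 0 := by
  rw [← Finset.sum_range_reflect]
  have e : ∀ i ∈ Finset.range (n + 2),
      a (n + 1 - (n + 2 - 1 - i)) * (V (n + 2 - 1 - i + 1) - V (n + 2 - 1 - i)) =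
        a i * V (n + 2 - i) - a i * V (n + 1 - i) := by
    intro i hi
    have hi := Finset.mem_range.1 hi
    rw [show n + 1 - (n + 2 - 1 - i) = i by lia, show n + 2 - 1 - i + 1 = n + 2 - i by lia,
      show n + 2 - 1 - i = n + 1 - i by lia]
    ring
  rw [Finset.sum_congr rfl e, Finset.sum_sub_distrib, Finset.sum_range_succ,
    Finset.sum_range_succ (fun i => a i * V (n + 1 - i)),
    Finset.sum_range_succ (fun i => a i * V (n + 1 - i))]
  rw [show n + 2 - (n + 1) = 1 by lia, show n + 1 - n = 1 by lia, Nat.sub_self]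
  ring

/-- The discrete Grönwall inequality. -/
theorem le_mul_pow_of_le_add_mul_sum {x : ℕ → ℝ} {a b : ℝ} (hb : 0 ≤ b) {N : ℕ}
    (h : ∀ n < N, x n ≤ a + b * ∑ i ∈ Finset.range n, x i) :
    ∀ n < N, x n ≤ a * (1 + b) ^ n := by
  have key : ∀ n ≤ N, a + b * ∑ i ∈ Finset.range n, x i ≤ a * (1 + b) ^ n := by
    intro n
    induction n with
    | zero => simp
    | succ n ih =>
      intro hn
      rw [Finset.sum_range_succ, pow_succ]
      have h1 := ih (by lia)
      have h2 := mul_le_mul_of_nonneg_left ((h n hn).trans h1) hb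
      linarith
  exact fun n hn => (h n hn).trans (key n hn.le)

/-- The properties of the weights `a m i`, of `p m = 2 σ_m - 1` and of the coefficient `r = 1 / s_0`
of the initial step from which stability follows. -/
structure StableWeights (K : ℝ) (M : ℕ) (τ : ℝ) (p : ℕ → ℝ) (a : ℕ → ℕ → ℝ) (k : ℕ → ℝ)
    (r : ℝ) : Prop where
  mem_Ioo : ∀ m, 1 ≤ m → m < M → p m ∈ Set.Ioo (0 : ℝ) 1
  abs_sub_le : ∀ m, 1 ≤ m → m + 1 < M → |p (m + 1) - p m| ≤ K * τ
  nonneg : ∀ m, 1 ≤ m → m < M → ∀ i ≤ m, 0 ≤ a m i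
  succ_le : ∀ m, 1 ≤ m → m < M → ∀ i < m, a m (i + 1) ≤ a m i
  one_le : ∀ m, 1 ≤ m → m < M → ((1 + p m) / 2) ^ 2 * a m 1 ≤ p m * a m 0
  le_kernel : ∀ m, 1 ≤ m → m < M → ∀ i ≤ m, a m i ≤ K * k i
  abs_sub_le_kernel : ∀ m, 1 ≤ m → m + 1 < M → ∀ i < m, |a (m + 1) i - a m i| ≤ K * τ * k i
  kernel_nonneg : ∀ i, 0 ≤ k i
  sum_kernel_le : τ * ∑ i ∈ Finset.range M, k i ≤ K
  initial_nonneg : 0 ≤ r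
  initial_le : τ * r ≤ K

/-! ### Energy estimate with time-dependent weights, closed by the discrete Grönwall inequality. -/

section Stability

variable {Z : Type*} [AddCommGroup Z] [Module ℝ Z]

/-- The energy inequalities satisfied by the solutions of the scheme. -/
structure SchemeInequalities (Q B : LinearMap.BilinForm ℝ Z) (M : ℕ) (τ : ℝ) (p : ℕ → ℝ)
    (a : ℕ → ℕ → ℝ) (r : ℝ) (F : ℕ → ℝ) (w : ℕ → Z) : Prop where
  initial : Q (average (1 / 2) w 0) (τ⁻¹ • (w 1 - w 0)) +
    B (average (1 / 2) w 0) (r • (w 1 - w 0)) ≤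
      (B (average (1 / 2) w 0) (average (1 / 2) w 0) + F 0) / 2
  general : ∀ m, 1 ≤ m → m < M →
    Q (average ((1 + p m) / 2) w m) (timeDiff τ ((1 + p m) / 2) w m) +
      B (average ((1 + p m) / 2) w m)
        (∑ i ∈ Finset.range (m + 1), a m (m - i) • (w (i + 1) - w i)) ≤
      (B (average ((1 + p m) / 2) w m) (average ((1 + p m) / 2) w m) + F m) / 2

variable {Q B : LinearMap.BilinForm ℝ Z} {K : ℝ} {M : ℕ} {τ : ℝ} {p : ℕ → ℝ} {a : ℕ → ℕ → ℝ}
  {k : ℕ → ℝ} {r : ℝ} {F : ℕ → ℝ} {w : ℕ → Z}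

/-- The initial step is of Crank–Nicolson type, so both pairings are exact differences of squares.
The bound `τ r ≤ K` controls the fractional term at level `0`, and `τ ≤ 1/2` absorbs the term at
level `1`. -/
theorem energy_initial_le (hBs : ∀ x y, B x y = B y x) (hQs : ∀ x y, Q x y = Q y x)
    (hB0 : ∀ x, 0 ≤ B x x) (hBQ : ∀ x, B x x ≤ Q x x) (hτ : 0 < τ) (hτ' : τ ≤ 1 / 2)
    (hw : StableWeights K M τ p a k r) (h : SchemeInequalities Q B M τ p a r F w)
    (hF : 0 ≤ F 0) :
    Q (w 1) (w 1) ≤ (4 + 2 * K) * (Q (w 0) (w 0) + τ * F 0) := by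
  have hi := h.initial
  have havg := bilin_average_le hB0 (σ := 1 / 2) (by norm_num) w 0
  have hr := hw.initial_nonneg
  have hr' := hw.initial_le
  have e1 : Q (average (1 / 2) w 0) (τ⁻¹ • (w 1 - w 0)) =
      τ⁻¹ * ((Q (w 1) (w 1) - Q (w 0) (w 0)) / 2) := by
    simp only [average, zero_add, map_add, map_sub, LinearMap.add_apply, map_smul,
      LinearMap.smul_apply, smul_eq_mul, hQs (w 1) (w 0)]
    ring
  have e2 : B (average (1 / 2) w 0) (r • (w 1 - w 0)) =
      r * ((B (w 1) (w 1) - B (w 0) (w 0)) / 2) := by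
    simp only [average, zero_add, map_add, map_sub, LinearMap.add_apply, map_smul,
      LinearMap.smul_apply, smul_eq_mul, hBs (w 1) (w 0)]
    ring
  rw [e1, e2] at hi
  rw [zero_add] at havg
  have h1 := mul_le_mul_of_nonneg_left hi (show 0 ≤ 2 * τ by linarith)
  have e3 : 2 * τ * (τ⁻¹ * ((Q (w 1) (w 1) - Q (w 0) (w 0)) / 2) +
      r * ((B (w 1) (w 1) - B (w 0) (w 0)) / 2)) =
      Q (w 1) (w 1) - Q (w 0) (w 0) + τ * r * (B (w 1) (w 1) - B (w 0) (w 0)) := by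
    field_simp
  rw [e3] at h1
  have h2 : τ * r * B (w 0) (w 0) ≤ K * Q (w 0) (w 0) :=
    mul_le_mul hr' (hBQ _) (hB0 _) ((mul_nonneg hτ.le hr).trans hr')
  have h3 : 0 ≤ τ * r * B (w 1) (w 1) := mul_nonneg (mul_nonneg hτ.le hr) (hB0 _)
  have h4 : τ * (B (average (1 / 2) w 0) (average (1 / 2) w 0)) ≤
      τ * Q (w 1) (w 1) + τ * Q (w 0) (w 0) := by
    rw [← mul_add]
    exact mul_le_mul_of_nonneg_left (havg.trans (add_le_add (hBQ _) (hBQ _))) hτ.le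
  have h5 : τ * Q (w 1) (w 1) ≤ 1 / 2 * Q (w 1) (w 1) :=
    mul_le_mul_of_nonneg_right hτ' ((hB0 _).trans (hBQ _))
  have h6 : τ * Q (w 0) (w 0) ≤ 1 / 2 * Q (w 0) (w 0) :=
    mul_le_mul_of_nonneg_right hτ' ((hB0 _).trans (hBQ _))
  have h7 : 0 ≤ τ * F 0 := mul_nonneg hτ.le hF
  have h8 : 0 ≤ K * (τ * F 0) := mul_nonneg ((mul_nonneg hτ.le hr).trans hr') h7
  have h9 := (hB0 (w 0)).trans (hBQ _)
  linarith

/-- The memory on the right still carries the weights of the current level. Replacing them by those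
of the previous level is left to the summation, and the contributions of levels `0` and `1` are
bounded by the kernel. -/
theorem energy_step_le (hBs : ∀ x y, B x y = B y x) (hQs : ∀ x y, Q x y = Q y x)
    (hB0 : ∀ x, 0 ≤ B x x) (hBQ : ∀ x, B x x ≤ Q x x) (hτ : 0 < τ)
    (hw : StableWeights K M τ p a k r) (h : SchemeInequalities Q B M τ p a r F w) (n : ℕ)
    (hn : n + 1 < M) :
    pairEnergy Q (p (n + 1)) (w (n + 2)) (w (n + 1)) +
        τ * memoryEnergy a (fun j => B (w j) (w j)) (n + 1) ≤
      pairEnergy Q (p (n + 1)) (w (n + 1)) (w n) +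
        τ * (∑ i ∈ Finset.range n, a (n + 1) i * B (w (n + 1 - i)) (w (n + 1 - i))) +
        τ * (K * (Q (w 0) (w 0) + Q (w 1) (w 1)) * (k n + k (n + 1))) +
        τ * (Q (w (n + 2)) (w (n + 2)) + Q (w (n + 1)) (w (n + 1))) + τ * F (n + 1) := by
  have hp := hw.mem_Ioo (n + 1) (by lia) hn
  have h1 := pairEnergy_sub_le hQs (fun x => (hB0 x).trans (hBQ x)) hp.1.le hτ w n
  have h2 := half_sum_le_bilin_average hBs hB0 (m := n + 1) (by lia)
    (hw.nonneg _ (by lia) hn _ le_rfl) (hw.succ_le _ (by lia) hn) (hw.one_le _ (by lia) hn) w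
  rw [sum_weight_mul_sub_eq (a (n + 1)) (fun j => B (w j) (w j))] at h2
  have h3 := h.general (n + 1) (by lia) hn
  have h4 := bilin_average_le hB0 (σ := (1 + p (n + 1)) / 2)
    ⟨by linarith [hp.1], by linarith [hp.2]⟩ w (n + 1)
  rw [show n + 1 + 1 = n + 2 by ring] at h4
  have hK : 0 ≤ K := (mul_nonneg hτ.le hw.initial_nonneg).trans hw.initial_le
  have h5 : a (n + 1) n * B (w 1) (w 1) ≤ K * k n * (Q (w 0) (w 0) + Q (w 1) (w 1)) :=
    mul_le_mul (hw.le_kernel _ (by lia) hn _ (by lia))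
      ((hBQ _).trans (by linarith [(hB0 (w 0)).trans (hBQ _)])) (hB0 _)
      (mul_nonneg hK (hw.kernel_nonneg _))
  have h6 : a (n + 1) (n + 1) * B (w 0) (w 0) ≤
      K * k (n + 1) * (Q (w 0) (w 0) + Q (w 1) (w 1)) :=
    mul_le_mul (hw.le_kernel _ (by lia) hn _ (by lia))
      ((hBQ _).trans (by linarith [(hB0 (w 1)).trans (hBQ _)])) (hB0 _)
      (mul_nonneg hK (hw.kernel_nonneg _))
  have h7 : 0 ≤ a (n + 1) (n + 1) * B (w 1) (w 1) :=
    mul_nonneg (hw.nonneg _ (by lia) hn _ le_rfl) (hB0 _)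
  have h8 := hBQ (w (n + 2))
  have h9 := hBQ (w (n + 1))
  have key : 2 * Q (average ((1 + p (n + 1)) / 2) w (n + 1))
        (timeDiff τ ((1 + p (n + 1)) / 2) w (n + 1)) +
      (∑ i ∈ Finset.range (n + 1), a (n + 1) i * B (w (n + 2 - i)) (w (n + 2 - i))) ≤
      (∑ i ∈ Finset.range n, a (n + 1) i * B (w (n + 1 - i)) (w (n + 1 - i))) +
      (K * (Q (w 0) (w 0) + Q (w 1) (w 1)) * (k n + k (n + 1))) +
      (Q (w (n + 2)) (w (n + 2)) + Q (w (n + 1)) (w (n + 1))) + F (n + 1) := by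
    linarith
  have h10 := mul_le_mul_of_nonneg_left key hτ.le
  unfold memoryEnergy
  rw [show n + 1 + 1 = n + 2 by ring]
  linarith

/-- In the constant of the sum of the `X`, `8 K` pays for the change of `p`, `K ^ 2` for the change
of the weights, and `2` for the averaged velocity. The factor `5` comes from the first pair energy,
compared with the one for `p = 0`, which is `Q (w 1) (w 1)`. -/
theorem energy_le_sum (hBs : ∀ x y, B x y = B y x) (hQs : ∀ x y, Q x y = Q y x)
    (hB0 : ∀ x, 0 ≤ B x x) (hBQ : ∀ x, B x x ≤ Q x x) (hτ : 0 < τ)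
    (hw : StableWeights K M τ p a k r) (h : SchemeInequalities Q B M τ p a r F w)
    {X : ℕ → ℝ} (hX : ∀ m j, j ≤ m + 1 → Q (w j) (w j) ≤ X m) (hXm : Monotone X) (n : ℕ)
    (hn : n + 1 < M) :
    pairEnergy Q (p (n + 1)) (w (n + 2)) (w (n + 1)) +
        τ * memoryEnergy a (fun j => B (w j) (w j)) (n + 1) ≤
      5 * (Q (w 0) (w 0) + Q (w 1) (w 1)) +
      (8 * K + K ^ 2 + 2) * τ * ∑ i ∈ Finset.range (n + 1), X (i + 1) +
      K * (Q (w 0) (w 0) + Q (w 1) (w 1)) *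
        (τ * ∑ i ∈ Finset.range (n + 1), (k i + k (i + 1))) +
      τ * ∑ i ∈ Finset.range (n + 1), F (i + 1) := by
  have hQ0 : ∀ x, 0 ≤ Q x x := fun x => (hB0 x).trans (hBQ x)
  have hK : 0 ≤ K := (mul_nonneg hτ.le hw.initial_nonneg).trans hw.initial_le
  have hX0 : ∀ m, 0 ≤ X m := fun m => (hQ0 _).trans (hX m 0 (by lia))
  induction n with
  | zero =>
    have h1 := energy_step_le hBs hQs hB0 hBQ hτ hw h 0 hn
    have hp := hw.mem_Ioo 1 le_rfl hn
    have h2 := pairEnergy_le hQs hQ0 (Set.Ioo_subset_Icc_self hp) (q := 0) (by simp) (w 1) (w 0)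
    have h3 : pairEnergy Q 0 (w 1) (w 0) = Q (w 1) (w 1) := by simp [pairEnergy]
    have h4 : |p 1 - 0| * (4 * (Q (w 1) (w 1) + Q (w 0) (w 0))) ≤
        1 * (4 * (Q (w 1) (w 1) + Q (w 0) (w 0))) := by
      apply mul_le_mul_of_nonneg_right _ (by linarith [hQ0 (w 1), hQ0 (w 0)])
      rw [sub_zero, abs_of_pos hp.1]; exact hp.2.le
    simp only [zero_add, Finset.sum_range_zero, Finset.sum_range_one, mul_zero, add_zero]
      at h1 h2 ⊢
    have h5 : τ * (Q (w 2) (w 2) + Q (w 1) (w 1)) ≤ (8 * K + K ^ 2 + 2) * τ * X 1 := by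
      have := mul_le_mul_of_nonneg_left
        (add_le_add (hX 1 2 (by lia)) (hX 1 1 (by lia))) hτ.le
      have : 0 ≤ (8 * K + K ^ 2) * τ * X 1 := by have := hX0 1; positivity
      linarith
    linarith [hQ0 (w 0)]
  | succ n ih =>
    have h1 := energy_step_le hBs hQs hB0 hBQ hτ hw h (n + 1) hn
    have h2 := ih (by lia)
    have hp := hw.mem_Ioo (n + 1) (by lia) (by lia)
    have hp' := hw.mem_Ioo (n + 1 + 1) (by lia) hn
    have h3 := pairEnergy_le hQs hQ0 (Set.Ioo_subset_Icc_self hp') (Set.Ioo_subset_Icc_self hp)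
      (w (n + 2)) (w (n + 1))
    have hXX : X (n + 1) ≤ X (n + 1 + 1) := hXm (by lia)
    have h4 : |p (n + 1 + 1) - p (n + 1)| *
        (4 * (Q (w (n + 2)) (w (n + 2)) + Q (w (n + 1)) (w (n + 1)))) ≤
        K * τ * (4 * (X (n + 1 + 1) + X (n + 1 + 1))) := by
      apply mul_le_mul (hw.abs_sub_le _ (by lia) hn) _ (by linarith [hQ0 (w (n+2)), hQ0 (w (n+1))])
        (by positivity)
      linarith [hX (n + 1 + 1) (n + 2) (by lia), hX (n + 1 + 1) (n + 1) (by lia)]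
    -- Passing to the weights of the previous level costs `K τ k i` at lag `i`. All past energies
    -- are bounded by `X`, so the summed cost is `K τ X ∑ k i`, and `τ ∑ k i ≤ K` gives `K ^ 2 τ X`
    -- after the multiplication by `τ`.
    have h5 : τ * (∑ i ∈ Finset.range (n + 1),
        a (n + 1 + 1) i * B (w (n + 1 + 1 - i)) (w (n + 1 + 1 - i))) ≤
        τ * memoryEnergy a (fun j => B (w j) (w j)) (n + 1) +
          K ^ 2 * τ * X (n + 1 + 1) := by
      have h6 : ∑ i ∈ Finset.range (n + 1),
          a (n + 1 + 1) i * B (w (n + 1 + 1 - i)) (w (n + 1 + 1 - i)) ≤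
          memoryEnergy a (fun j => B (w j) (w j)) (n + 1) +
            ∑ i ∈ Finset.range (n + 1), K * τ * X (n + 1 + 1) * k i := by
        rw [memoryEnergy, ← Finset.sum_add_distrib]
        refine Finset.sum_le_sum fun i hi => ?_
        have hi := Finset.mem_range.1 hi
        have h7 := (le_abs_self _).trans (hw.abs_sub_le_kernel (n + 1) (by lia) hn i hi)
        have h8 : B (w (n + 1 + 1 - i)) (w (n + 1 + 1 - i)) ≤ X (n + 1 + 1) :=
          (hBQ _).trans (hX _ _ (by lia))
        have h9 := mul_le_mul_of_nonneg_right h7 (hB0 (w (n + 1 + 1 - i)))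
        have h10 : K * τ * k i * B (w (n + 1 + 1 - i)) (w (n + 1 + 1 - i)) ≤
            K * τ * k i * X (n + 1 + 1) :=
          mul_le_mul_of_nonneg_left h8 (mul_nonneg (by positivity) (hw.kernel_nonneg i))
        linarith
      rw [← Finset.mul_sum] at h6
      have h7 : ∑ i ∈ Finset.range (n + 1), k i ≤ ∑ i ∈ Finset.range M, k i :=
        Finset.sum_le_sum_of_subset_of_nonneg (Finset.range_mono (by lia))
          fun i _ _ => hw.kernel_nonneg i
      have h8 : τ * ∑ i ∈ Finset.range (n + 1), k i ≤ K :=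
        (mul_le_mul_of_nonneg_left h7 hτ.le).trans hw.sum_kernel_le
      have h9 := mul_le_mul_of_nonneg_left h8
        (show 0 ≤ K * τ * X (n + 1 + 1) by have := hX0 (n + 1 + 1); positivity)
      have h10 := mul_le_mul_of_nonneg_left h6 hτ.le
      linarith
    have h6 : τ * (Q (w (n + 1 + 2)) (w (n + 1 + 2)) + Q (w (n + 1 + 1)) (w (n + 1 + 1))) ≤
        τ * (2 * X (n + 1 + 1)) := by
      apply mul_le_mul_of_nonneg_left _ hτ.le
      linarith [hX (n + 1 + 1) (n + 1 + 2) (by lia), hX (n + 1 + 1) (n + 1 + 1) (by lia)]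
    rw [Finset.sum_range_succ, Finset.sum_range_succ (fun i => k i + k (i + 1)),
      Finset.sum_range_succ (fun i => F (i + 1))]
    linarith

theorem exists_stability_constant {T K : ℝ} (hT : 0 < T) (hK : 0 < K) :
    ∃ τ₀ > 0, ∃ C > 0, ∀ {Z : Type} [AddCommGroup Z] [Module ℝ Z]
      (Q B : LinearMap.BilinForm ℝ Z), (∀ x y, B x y = B y x) → (∀ x y, Q x y = Q y x) →
      (∀ x, 0 ≤ B x x) → (∀ x, B x x ≤ Q x x) →
      ∀ (M : ℕ) (τ : ℝ), 0 < τ → M * τ ≤ T → τ ≤ τ₀ →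
      ∀ (p : ℕ → ℝ) (a : ℕ → ℕ → ℝ) (k : ℕ → ℝ) (r : ℝ), StableWeights K M τ p a k r →
      ∀ (F : ℕ → ℝ), (∀ m, 0 ≤ F m) → ∀ (w : ℕ → Z), SchemeInequalities Q B M τ p a r F w →
      ∀ n ≤ M, Q (w n) (w n) ≤
        C * (Q (w 0) (w 0) + τ * F 0 + τ * ∑ i ∈ Finset.Ico 1 n, F i) := by
  set c := 8 * K + K ^ 2 + 2 with hc
  have hc0 : 0 < c := by positivity
  set D := (5 + 2 * K ^ 2) * (5 + 2 * K) + 1 with hD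
  have hD1 : 1 ≤ D := by rw [hD]; linarith [show 0 ≤ (5 + 2 * K ^ 2) * (5 + 2 * K) by positivity]
  -- The bound `1/2` is for the initial step; `1 / (4 c)` allows the newest term of the Grönwall sum
  -- to be absorbed.
  refine ⟨min (1 / 2) (1 / (4 * c)), by positivity, 4 * D * Real.exp (4 * c * T), by positivity, ?_⟩
  intro Z _ _ Q B hBs hQs hB0 hBQ M τ hτ hMτ hτ0 p a k r hw F hF w h n hn
  have hτ1 : τ ≤ 1 / 2 := hτ0.trans (min_le_left _ _)
  have hτ2 : 4 * c * τ ≤ 1 := by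
    have := hτ0.trans (min_le_right _ _)
    rw [le_div_iff₀ (by positivity)] at this
    linarith
  have hQ0 : ∀ x, 0 ≤ Q x x := fun x => (hB0 x).trans (hBQ x)
  have hexp : 1 ≤ Real.exp (4 * c * T) := Real.one_le_exp (by positivity)
  have hS : ∀ m, 0 ≤ τ * ∑ i ∈ Finset.Ico 1 m, F i := fun m =>
    mul_nonneg hτ.le (Finset.sum_nonneg fun i _ => hF i)
  set R₀ := Q (w 0) (w 0) + τ * F 0 with hR₀
  have hR₀0 : 0 ≤ R₀ := add_nonneg (hQ0 _) (mul_nonneg hτ.le (hF 0))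
  have h1 : Q (w 1) (w 1) ≤ (4 + 2 * K) * R₀ :=
    energy_initial_le hBs hQs hB0 hBQ hτ hτ1 hw h (hF 0)
  have hD01 : Q (w 0) (w 0) + Q (w 1) (w 1) ≤ (5 + 2 * K) * R₀ := by
    linarith [mul_nonneg hτ.le (hF 0)]
  set R := D * (R₀ + τ * ∑ i ∈ Finset.Ico 1 n, F i) with hR
  have hR0 : 0 ≤ R := mul_nonneg (by linarith) (add_nonneg hR₀0 (hS n))
  have hRD : (5 + 2 * K ^ 2) * (Q (w 0) (w 0) + Q (w 1) (w 1)) +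
      τ * ∑ i ∈ Finset.Ico 1 n, F i ≤ R := by
    have e1 := mul_le_mul_of_nonneg_left hD01 (show 0 ≤ 5 + 2 * K ^ 2 by positivity)
    have e2 := mul_nonneg (show 0 ≤ (5 + 2 * K ^ 2) * (5 + 2 * K) by positivity) (hS n)
    rw [hR, hD]
    linarith
  have hDD : Q (w 0) (w 0) + Q (w 1) (w 1) ≤ R := by
    have e1 := mul_nonneg (show 0 ≤ 4 + 2 * K ^ 2 by positivity)
      (add_nonneg (hQ0 (w 0)) (hQ0 (w 1)))
    linarith [hS n]
  suffices hmain : Q (w n) (w n) ≤ 4 * R * Real.exp (4 * c * T) by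
    rw [hR] at hmain
    linarith
  have hR4 : R ≤ 4 * R * Real.exp (4 * c * T) := by nlinarith
  rcases n with _ | _ | N
  · exact (show Q (w 0) (w 0) ≤ R by linarith [hQ0 (w 1)]).trans hR4
  · exact (show Q (w 1) (w 1) ≤ R by linarith [hQ0 (w 0)]).trans hR4
  -- `X m` is the maximum of the energy over the levels `0, …, m + 1`. The bound of each step
  -- increases with the level, so it passes to the running maximum.
  set X : ℕ → ℝ := fun m => partialSups (fun j => Q (w j) (w j)) (m + 1) with hXdef
  have hX : ∀ m j, j ≤ m + 1 → Q (w j) (w j) ≤ X m := fun m j hj =>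
    le_partialSups_of_le (fun j => Q (w j) (w j)) hj
  have hXm : Monotone X := fun i j hij => (partialSups _).monotone (by lia)
  have hX0 : ∀ m, 0 ≤ X m := fun m => (hQ0 _).trans (hX m 0 (by lia))
  have hstep : ∀ m ≤ N, Q (w (m + 2)) (w (m + 2)) ≤
      2 * R + 2 * c * τ * ∑ i ∈ Finset.range (m + 1), X (i + 1) := by
    intro m hm
    have e1 := energy_le_sum hBs hQs hB0 hBQ hτ hw h hX hXm m (by lia)
    have hp := hw.mem_Ioo (m + 1) (by lia) (by lia)
    have e2 := half_le_pairEnergy hQs hQ0 hp (w (m + 2)) (w (m + 1))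
    have e3 : 0 ≤ τ * memoryEnergy a (fun j => B (w j) (w j)) (m + 1) := by
      refine mul_nonneg hτ.le (Finset.sum_nonneg fun i hi => mul_nonneg ?_ (hB0 _))
      exact hw.nonneg _ (by lia) (by lia) _ (by have := Finset.mem_range.1 hi; lia)
    have e4 : τ * ∑ i ∈ Finset.range (m + 1), (k i + k (i + 1)) ≤ 2 * K := by
      have f1 : ∑ i ∈ Finset.range (m + 1), k i ≤ ∑ i ∈ Finset.range M, k i :=
        Finset.sum_le_sum_of_subset_of_nonneg (Finset.range_mono (by lia))
          fun i _ _ => hw.kernel_nonneg i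
      have f2 : ∑ i ∈ Finset.range (m + 1), k (i + 1) ≤ ∑ i ∈ Finset.range M, k i := by
        have f3 : ∑ i ∈ Finset.range (m + 1 + 1), k i ≤ ∑ i ∈ Finset.range M, k i :=
          Finset.sum_le_sum_of_subset_of_nonneg (Finset.range_mono (by lia))
            fun i _ _ => hw.kernel_nonneg i
        rw [Finset.sum_range_succ'] at f3
        linarith [hw.kernel_nonneg 0]
      rw [Finset.sum_add_distrib]
      have := mul_le_mul_of_nonneg_left (add_le_add f1 f2) hτ.le
      linarith [hw.sum_kernel_le]
    have e5 := mul_le_mul_of_nonneg_left e4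
      (mul_nonneg hK.le (add_nonneg (hQ0 (w 0)) (hQ0 (w 1))))
    have e6 : τ * ∑ i ∈ Finset.range (m + 1), F (i + 1) ≤
        τ * ∑ i ∈ Finset.Ico 1 (N + 1 + 1), F i := by
      apply mul_le_mul_of_nonneg_left _ hτ.le
      rw [Finset.sum_Ico_eq_sum_range]
      simp only [add_comm 1]
      exact Finset.sum_le_sum_of_subset_of_nonneg (Finset.range_mono (by lia))
        fun i _ _ => hF _
    linarith
  have hXle : ∀ m ≤ N, X (m + 1) ≤
      2 * R + 2 * c * τ * ∑ i ∈ Finset.range (m + 1), X (i + 1) := by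
    intro m hm
    refine partialSups_le _ _ _ fun j hj => ?_
    have hsum : 0 ≤ 2 * c * τ * ∑ i ∈ Finset.range (m + 1), X (i + 1) :=
      mul_nonneg (by positivity) (Finset.sum_nonneg fun i _ => hX0 _)
    rcases j with _ | _ | j
    · linarith [hQ0 (w 1)]
    · simp only [zero_add]
      linarith [hQ0 (w 0)]
    · refine (hstep j (by lia)).trans ?_
      refine add_le_add le_rfl (mul_le_mul_of_nonneg_left ?_ (by positivity))
      exact Finset.sum_le_sum_of_subset_of_nonneg
        (Finset.range_mono (show j + 1 ≤ m + 1 by lia)) fun i _ _ => hX0 _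
  have hgr : ∀ m < N + 1, X (m + 1) ≤ 4 * R + 4 * c * τ * ∑ i ∈ Finset.range m, X (i + 1) := by
    intro m hm
    have e1 := hXle m (by lia)
    rw [Finset.sum_range_succ] at e1
    -- As `2 c τ ≤ 1/2`, the term `X (m + 1)` moves to the left, which doubles the constants and
    -- makes the inequality explicit.
    have e2 := mul_le_mul_of_nonneg_right hτ2 (hX0 (m + 1))
    linarith
  have hfin := le_mul_pow_of_le_add_mul_sum (x := fun m => X (m + 1)) (by positivity) hgr N
    (by lia)
  refine (hX (N + 1) (N + 2) (by lia)).trans (hfin.trans ?_)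
  apply mul_le_mul_of_nonneg_left _ (by positivity)
  calc (1 + 4 * c * τ) ^ N ≤ Real.exp (4 * c * τ) ^ N := by
        gcongr
        linarith [Real.add_one_le_exp (4 * c * τ)]
    _ = Real.exp (N * (4 * c * τ)) := by rw [← Real.exp_nat_mul]
    _ ≤ Real.exp (4 * c * T) := by
        apply Real.exp_le_exp.2
        have : (N : ℝ) ≤ M := by exact_mod_cast (by lia : N ≤ M)
        have h2 : N * τ ≤ T := (mul_le_mul_of_nonneg_right this hτ.le).trans hMτ
        nlinarith

end Stability

/-! ### Geometry of the elements and the faces -/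

section Geometry

variable {d : ℕ}

theorem isCompact_referenceElement (kind : ElementKind) :
    IsCompact (referenceElement d kind) := by
  have hcube : IsCompact {x : Space d | ∀ i, 0 ≤ x i ∧ x i ≤ 1} := by
    have h : IsCompact (Set.pi Set.univ fun _ : Fin d => Set.Icc (0 : ℝ) 1) :=
      isCompact_univ_pi fun _ => isCompact_Icc
    have h2 := (EuclideanSpace.equiv (Fin d) ℝ).toHomeomorph.isCompact_preimage.2 h
    convert h2 using 1
    ext x
    simp only [Set.mem_ofPred_eq, Set.mem_preimage, Set.mem_univ_pi, Set.mem_Icc]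
    rfl
  cases kind with
  | tensor => exact hcube
  | simplex =>
    refine hcube.of_isClosed_subset ?_ fun x hx i => ⟨hx.1 i, ?_⟩
    · have e : referenceElement d .simplex =
          (⋂ i, {x : Space d | 0 ≤ x i}) ∩ {x : Space d | ∑ i, x i ≤ 1} := by
        ext x; simp [referenceElement]
      rw [e]
      exact (isClosed_iInter fun i => isClosed_le continuous_const (by fun_prop)).inter
        (isClosed_le (by fun_prop) continuous_const)
    · exact (Finset.single_le_sum (fun j _ => hx.1 j) (Finset.mem_univ i)).trans hx.2

theorem convex_referenceElement (kind : ElementKind) :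
    Convex ℝ (referenceElement d kind) := by
  cases kind with
  | tensor =>
    intro x hx y hy a b ha hb hab i
    have h1 := mul_le_mul_of_nonneg_left (hx i).2 ha
    have h2 := mul_le_mul_of_nonneg_left (hy i).2 hb
    have h3 := mul_nonneg ha (hx i).1
    have h4 := mul_nonneg hb (hy i).1
    simp only [PiLp.add_apply, PiLp.smul_apply, smul_eq_mul]
    constructor <;> linarith
  | simplex =>
    intro x hx y hy a b ha hb hab
    refine ⟨fun i => ?_, ?_⟩
    · have h3 := mul_nonneg ha (hx.1 i)
      have h4 := mul_nonneg hb (hy.1 i)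
      simp only [PiLp.add_apply, PiLp.smul_apply, smul_eq_mul]
      linarith
    · have h1 := mul_le_mul_of_nonneg_left hx.2 ha
      have h2 := mul_le_mul_of_nonneg_left hy.2 hb
      simp only [PiLp.add_apply, PiLp.smul_apply, smul_eq_mul, Finset.sum_add_distrib,
        ← Finset.mul_sum]
      linarith

theorem interior_referenceElement_nonempty (kind : ElementKind) :
    (interior (referenceElement d kind)).Nonempty := by
  let U : Set (Space d) := {x | (∀ i, 0 < x i) ∧ ∑ i, x i < 1}
  have hU : IsOpen U := by
    have e : U = (⋂ i, {x : Space d | 0 < x i}) ∩ {x : Space d | ∑ i, x i < 1} := by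
      ext x; simp [U]
    rw [e]
    exact (isOpen_iInter_of_finite fun i => isOpen_lt continuous_const (by fun_prop)).inter
      (isOpen_lt (by fun_prop) continuous_const)
  have hsub : U ⊆ referenceElement d kind := by
    intro x hx
    cases kind with
    | simplex => exact ⟨fun i => (hx.1 i).le, hx.2.le⟩
    | tensor =>
      exact fun i => ⟨(hx.1 i).le, (Finset.single_le_sum (fun j _ => (hx.1 j).le)
        (Finset.mem_univ i)).trans hx.2.le⟩
  refine ⟨WithLp.toLp 2 fun _ => 1 / ((d : ℝ) + 1), interior_maximal hsub hU ⟨fun i => ?_, ?_⟩⟩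
  · simp only
    positivity
  · simp only [Finset.sum_const, Finset.card_univ, Fintype.card_fin, nsmul_eq_mul]
    rw [mul_one_div, div_lt_one (by positivity)]
    linarith

theorem isCompact_image_referenceElement (kind : ElementKind) (A : Space d ≃ᵃ[ℝ] Space d) :
    IsCompact (A '' referenceElement d kind) :=
  (isCompact_referenceElement kind).image
    (AffineMap.continuous_of_finiteDimensional A.toAffineMap)

theorem convex_image_referenceElement (kind : ElementKind) (A : Space d ≃ᵃ[ℝ] Space d) :
    Convex ℝ (A '' referenceElement d kind) :=
  (convex_referenceElement kind).affine_image A.toAffineMap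

theorem interior_image_referenceElement_nonempty (kind : ElementKind)
    (A : Space d ≃ᵃ[ℝ] Space d) : (interior (A '' referenceElement d kind)).Nonempty := by
  have h : IsOpen (A '' interior (referenceElement d kind)) := by
    rw [show A '' interior (referenceElement d kind) =
      A.symm ⁻¹' interior (referenceElement d kind) from A.toEquiv.image_eq_preimage_symm _]
    exact isOpen_interior.preimage (AffineMap.continuous_of_finiteDimensional A.symm.toAffineMap)
  exact ((interior_referenceElement_nonempty kind).image _).mono
    (interior_maximal (Set.image_mono interior_subset) h)

/-- Bounded subsets of hyperplanes have finite `(d - 1)`-dimensional measure. -/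
theorem euclideanHausdorffMeasure_lt_top_of_subset_hyperplane {S : Set (Space d)}
    (hS : Bornology.IsBounded S) {g : StrongDual ℝ (Space d)} (hg : g ≠ 0) {c : ℝ}
    (h : ∀ x ∈ S, g x = c) : (μHE[d - 1] : Measure (Space d)) S < ⊤ := by
  rcases S.eq_empty_or_nonempty with rfl | ⟨x₀, hx₀⟩
  · simp
  let W : Submodule ℝ (Space d) := LinearMap.ker (g : Space d →ₗ[ℝ] ℝ)
  have hg' : (g : Space d →ₗ[ℝ] ℝ) ≠ 0 := fun h0 => hg (by
    ext x; exact congrArg (fun l : Space d →ₗ[ℝ] ℝ => l x) h0)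
  have hW : Module.finrank ℝ W = d - 1 := by
    have := Module.Dual.finrank_ker_add_one_of_ne_zero (f := (g : Space d →ₗ[ℝ] ℝ)) hg'
    rw [finrank_euclideanSpace_fin] at this
    exact Nat.eq_sub_of_add_eq this
  -- The hyperplane is an isometric copy of its direction space, of dimension `d - 1`, on which the
  -- normalized Hausdorff measure is Lebesgue measure.
  let ι : W → Space d := fun y => (y : Space d) + x₀
  have hι : Isometry ι := (isometry_add_right x₀).comp isometry_subtype_coe
  have hSι : S ⊆ ι '' (ι ⁻¹' S) := by
    intro x hx
    have hxW : x - x₀ ∈ W := by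
      change g (x - x₀) = 0
      rw [map_sub, h x hx, h x₀ hx₀, sub_self]
    have e : ι ⟨x - x₀, hxW⟩ = x := by simp [ι]
    exact ⟨⟨x - x₀, hxW⟩, by rw [Set.mem_preimage, e]; exact hx, e⟩
  have hb : Bornology.IsBounded (ι ⁻¹' S) := by
    obtain ⟨C, hC⟩ := Metric.isBounded_iff.1 hS
    exact Metric.isBounded_iff.2 ⟨C, fun x hx y hy => by
      rw [← hι.dist_eq]; exact hC hx hy⟩
  refine (measure_mono hSι).trans_lt ?_
  rw [hι.euclideanHausdorffMeasure_image, ← hW,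
    InnerProductSpace.euclideanHausdorffMeasure_eq_volume]
  exact hb.measure_lt_top

theorem isCompact_interface (kind : ElementKind) (A A' : Space d ≃ᵃ[ℝ] Space d)
    (shift : Space d) : IsCompact (interface kind A A' shift) :=
  (isCompact_image_referenceElement kind A).inter
    ((isCompact_image_referenceElement kind A').image (continuous_add_const shift))

/-- Hahn–Banach separates the disjoint interiors, and each convex body is the closure of its
interior, so the intersection lies in a hyperplane. Finite measure makes continuous traces
integrable; without integrability the face integrals could not be split by linearity. -/
theorem interface_measure_lt_top {kind : ElementKind} {A A' : Space d ≃ᵃ[ℝ] Space d}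
    {shift : Space d} (h : Disjoint (interior (A '' referenceElement d kind))
      (interior ((fun x => x + shift) '' (A' '' referenceElement d kind)))) :
    (μHE[d - 1] : Measure (Space d)) (interface kind A A' shift) < ⊤ := by
  set K := A '' referenceElement d kind with hK
  set K' := (fun x => x + shift) '' (A' '' referenceElement d kind) with hK'
  have hKc : Convex ℝ K := convex_image_referenceElement kind A
  have hKi : (interior K).Nonempty := interior_image_referenceElement_nonempty kind A
  have hKcl : closure (interior K) = K := by
    rw [hKc.closure_interior_eq_closure_of_nonempty_interior hKi]
    exact (isCompact_image_referenceElement kind A).isClosed.closure_eq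
  have hKc' : Convex ℝ K' := by
    have := (convex_image_referenceElement kind A').translate shift
    simpa only [hK', add_comm shift] using this
  have hKi' : (interior K').Nonempty := by
    have e := (Homeomorph.addRight shift).image_interior (A' '' referenceElement d kind)
    rw [Homeomorph.coe_addRight] at e
    rw [hK', ← e]
    exact (interior_image_referenceElement_nonempty kind A').image _
  have hKcl' : closure (interior K') = K' := by
    rw [hKc'.closure_interior_eq_closure_of_nonempty_interior hKi']
    exact ((isCompact_image_referenceElement kind A').image
      (continuous_add_const shift)).isClosed.closure_eq
  obtain ⟨g, c, hgK, hgK'⟩ := geometric_hahn_banach_open hKc.interior isOpen_interior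
    hKc'.interior h
  have hg0 : g ≠ 0 := by
    rintro rfl
    obtain ⟨x, hx⟩ := hKi
    obtain ⟨y, hy⟩ := hKi'
    have h1 := hgK x hx
    have h2 := hgK' y hy
    simp only [zero_apply] at h1 h2
    linarith
  have h1 : K ⊆ {x | g x ≤ c} := by
    rw [← hKcl]
    exact closure_minimal (fun x hx => (hgK x hx).le) (isClosed_le g.continuous continuous_const)
  have h2 : K' ⊆ {x | c ≤ g x} := by
    rw [← hKcl']
    exact closure_minimal (fun x hx => hgK' x hx) (isClosed_le continuous_const g.continuous)
  exact euclideanHausdorffMeasure_lt_top_of_subset_hyperplane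
    (isCompact_interface kind A A' shift).isBounded hg0
    fun x hx => le_antisymm (h1 hx.1) (h2 hx.2)

theorem contDiff_of_mem_localPolynomials {kind : ElementKind} {A : Space d ≃ᵃ[ℝ] Space d} {s : ℕ}
    {w : Space d → ℝ} (hw : w ∈ localPolynomials kind A s) : ContDiff ℝ 1 w := by
  obtain ⟨p, -, h⟩ := hw
  rw [show w = fun x => MvPolynomial.eval (A.symm x) p from funext h]
  have hA : ContDiff ℝ 1 fun x => A.symm x := by
    have hc : Continuous A.symm.toAffineMap := AffineMap.continuous_of_finiteDimensional _
    exact (ContinuousAffineMap.contDiff (⟨A.symm.toAffineMap, hc⟩ : Space d →ᴬ[ℝ] Space d))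
  have hcoord : ∀ i, ContDiff ℝ 1 fun x => A.symm x i := fun i =>
    (EuclideanSpace.proj (𝕜 := ℝ) i).contDiff.comp hA
  clear h
  induction p using MvPolynomial.induction_on with
  | C a => simpa using contDiff_const
  | add p q hp hq => simpa using hp.add hq
  | mul_X p i hp => simpa using hp.mul (hcoord i)

theorem gradient_add' {f g : Space d → ℝ} (hf : Differentiable ℝ f) (hg : Differentiable ℝ g)
    (x : Space d) : ∇ (f + g) x = ∇ f x + ∇ g x := by
  simp only [gradient, fderiv_add hf.differentiableAt hg.differentiableAt, map_add]

theorem gradient_smul' {f : Space d → ℝ} (hf : Differentiable ℝ f) (c : ℝ)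
    (x : Space d) : ∇ (c • f) x = c • ∇ f x := by
  simp only [gradient, fderiv_const_smul hf.differentiableAt, map_smul]

theorem continuous_gradient {f : Space d → ℝ} (hf : ContDiff ℝ 1 f) : Continuous (∇ f) :=
  (InnerProductSpace.toDual ℝ (Space d)).symm.continuous.comp (hf.continuous_fderiv one_ne_zero)

theorem integrableOn_of_continuous {μ : Measure (Space d)} {S : Set (Space d)} (hS : IsCompact S)
    (hμ : μ S < ⊤) {g : Space d → ℝ} (hg : Continuous g) : IntegrableOn g S μ := by
  obtain ⟨C, hC⟩ := hS.exists_bound_of_continuousOn hg.continuousOn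
  exact Measure.integrableOn_of_bounded hμ.ne hg.aestronglyMeasurable
    (ae_restrict_of_forall_mem hS.measurableSet hC)

end Geometry

namespace PeriodicMesh

/-! ### Energy inequality of the spatial discretization -/

variable {d : ℕ} (𝒯 : PeriodicMesh d)

/-- The elementwise continuously differentiable functions. -/
def smoothSpace : Submodule ℝ 𝒯.Broken where
  carrier := {w | ∀ k, ContDiff ℝ 1 (w k)}
  add_mem' hv hw k := (hv k).add (hw k)
  zero_mem' _ := contDiff_const
  smul_mem' c _ hw k := (hw k).const_smul c

theorem mem_smoothSpace {w : 𝒯.Broken} : w ∈ 𝒯.smoothSpace ↔ ∀ k, ContDiff ℝ 1 (w k) := Iff.rfl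

theorem contDiff (w : 𝒯.smoothSpace) (k : Fin 𝒯.card) : ContDiff ℝ 1 (w.1 k) :=
  𝒯.mem_smoothSpace.1 w.2 k

theorem mem_smoothSpace_of_mem_polySpace {s : ℕ} {w : 𝒯.Broken} (hw : w ∈ 𝒯.polySpace s) :
    w ∈ 𝒯.smoothSpace :=
  𝒯.mem_smoothSpace.2 fun k => contDiff_of_mem_localPolynomials (hw k)

theorem add_mem_polySpace {s : ℕ} {v w : 𝒯.Broken} (hv : v ∈ 𝒯.polySpace s)
    (hw : w ∈ 𝒯.polySpace s) : v + w ∈ 𝒯.polySpace s := fun k => by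
  obtain ⟨p, hp, h⟩ := hv k
  obtain ⟨q, hq, h'⟩ := hw k
  exact ⟨p + q, add_mem hp hq, fun x => by simp [h, h']⟩

theorem smul_mem_polySpace {s : ℕ} {w : 𝒯.Broken} (c : ℝ) (hw : w ∈ 𝒯.polySpace s) :
    c • w ∈ 𝒯.polySpace s := fun k => by
  obtain ⟨p, hp, h⟩ := hw k
  exact ⟨c • p, Submodule.smul_mem _ c hp, fun x => by simp [h, MvPolynomial.smul_eval]⟩

theorem isCompact_element (k : Fin 𝒯.card) : IsCompact (𝒯.element k) :=
  isCompact_image_referenceElement _ _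

theorem integrableOn_element (k : Fin 𝒯.card) {g : Space d → ℝ} (hg : Continuous g) :
    IntegrableOn g (𝒯.element k) :=
  integrableOn_of_continuous (𝒯.isCompact_element k) (𝒯.isCompact_element k).measure_lt_top hg

theorem integrableOn_faceSet {F : 𝒯.Face} (hF : F ∈ 𝒯.faces) {g : Space d → ℝ}
    (hg : Continuous g) : IntegrableOn g (𝒯.faceSet F) μHE[d - 1] := by
  obtain ⟨k, l, z⟩ := F
  exact integrableOn_of_continuous (isCompact_interface _ _ _ _)
    (interface_measure_lt_top (𝒯.nonoverlapping k l z
      ((𝒯.mem_faces_or_swap k l z).1 (Or.inl hF)).1)) hg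

theorem continuous_mul (v w : 𝒯.smoothSpace) (k : Fin 𝒯.card) :
    Continuous fun x => v.1 k x * w.1 k x :=
  (𝒯.contDiff v k).continuous.mul (𝒯.contDiff w k).continuous

/-- The `L²` inner product. -/
noncomputable def massForm : LinearMap.BilinForm ℝ 𝒯.smoothSpace :=
  LinearMap.mk₂ ℝ (fun v w => ∑ k, ∫ x in 𝒯.element k, v.1 k x * w.1 k x)
    (fun u v w => by
      rw [← Finset.sum_add_distrib]
      refine Finset.sum_congr rfl fun k _ => ?_
      rw [← integral_add (𝒯.integrableOn_element k (𝒯.continuous_mul u w k))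
        (𝒯.integrableOn_element k (𝒯.continuous_mul v w k))]
      refine integral_congr_ae (Filter.Eventually.of_forall fun x => ?_)
      exact add_mul (u.1 k x) (v.1 k x) (w.1 k x))
    (fun c v w => by
      rw [smul_eq_mul, Finset.mul_sum]
      refine Finset.sum_congr rfl fun k _ => ?_
      rw [← integral_const_mul]
      refine integral_congr_ae (Filter.Eventually.of_forall fun x => ?_)
      exact mul_assoc c (v.1 k x) (w.1 k x))
    (fun u v w => by
      rw [← Finset.sum_add_distrib]
      refine Finset.sum_congr rfl fun k _ => ?_
      rw [← integral_add (𝒯.integrableOn_element k (𝒯.continuous_mul u v k))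
        (𝒯.integrableOn_element k (𝒯.continuous_mul u w k))]
      refine integral_congr_ae (Filter.Eventually.of_forall fun x => ?_)
      exact mul_add (u.1 k x) (v.1 k x) (w.1 k x))
    (fun c v w => by
      rw [smul_eq_mul, Finset.mul_sum]
      refine Finset.sum_congr rfl fun k _ => ?_
      rw [← integral_const_mul]
      refine integral_congr_ae (Filter.Eventually.of_forall fun x => ?_)
      exact mul_left_comm (v.1 k x) c (w.1 k x))

theorem massForm_apply (v w : 𝒯.smoothSpace) :
    𝒯.massForm v w = ∑ k, ∫ x in 𝒯.element k, v.1 k x * w.1 k x := rfl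

theorem continuous_inner_gradient (v w : 𝒯.smoothSpace) (k : Fin 𝒯.card) :
    Continuous fun x => (inner ℝ (∇ (v.1 k) x) (∇ (w.1 k) x) : ℝ) :=
  (continuous_gradient (𝒯.contDiff v k)).inner (continuous_gradient (𝒯.contDiff w k))

/-- The `L²` inner product of the elementwise gradients. -/
noncomputable def stiffnessForm : LinearMap.BilinForm ℝ 𝒯.smoothSpace :=
  LinearMap.mk₂ ℝ (fun v w => ∑ k, ∫ x in 𝒯.element k, inner ℝ (∇ (v.1 k) x) (∇ (w.1 k) x))
    (fun u v w => by
      rw [← Finset.sum_add_distrib]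
      refine Finset.sum_congr rfl fun k _ => ?_
      rw [← integral_add (𝒯.integrableOn_element k (𝒯.continuous_inner_gradient u w k))
        (𝒯.integrableOn_element k (𝒯.continuous_inner_gradient v w k))]
      refine integral_congr_ae (Filter.Eventually.of_forall fun x => ?_)
      have := gradient_add' ((𝒯.contDiff u k).differentiable one_ne_zero)
        ((𝒯.contDiff v k).differentiable one_ne_zero) x
      simp only [Submodule.coe_add, Pi.add_apply, this, inner_add_left])
    (fun c v w => by
      rw [smul_eq_mul, Finset.mul_sum]
      refine Finset.sum_congr rfl fun k _ => ?_
      rw [← integral_const_mul]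
      refine integral_congr_ae (Filter.Eventually.of_forall fun x => ?_)
      have := gradient_smul' ((𝒯.contDiff v k).differentiable one_ne_zero) c x
      simp only [Submodule.coe_smul, Pi.smul_apply, this, real_inner_smul_left])
    (fun u v w => by
      rw [← Finset.sum_add_distrib]
      refine Finset.sum_congr rfl fun k _ => ?_
      rw [← integral_add (𝒯.integrableOn_element k (𝒯.continuous_inner_gradient u v k))
        (𝒯.integrableOn_element k (𝒯.continuous_inner_gradient u w k))]
      refine integral_congr_ae (Filter.Eventually.of_forall fun x => ?_)
      have := gradient_add' ((𝒯.contDiff v k).differentiable one_ne_zero)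
        ((𝒯.contDiff w k).differentiable one_ne_zero) x
      simp only [Submodule.coe_add, Pi.add_apply, this, inner_add_right])
    (fun c v w => by
      rw [smul_eq_mul, Finset.mul_sum]
      refine Finset.sum_congr rfl fun k _ => ?_
      rw [← integral_const_mul]
      refine integral_congr_ae (Filter.Eventually.of_forall fun x => ?_)
      have := gradient_smul' ((𝒯.contDiff w k).differentiable one_ne_zero) c x
      simp only [Submodule.coe_smul, Pi.smul_apply, this, real_inner_smul_right])

theorem stiffnessForm_apply (v w : 𝒯.smoothSpace) :
    𝒯.stiffnessForm v w =
      ∑ k, ∫ x in 𝒯.element k, inner ℝ (∇ (v.1 k) x) (∇ (w.1 k) x) := rfl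

theorem massForm_comm (v w : 𝒯.smoothSpace) : 𝒯.massForm v w = 𝒯.massForm w v := by
  simp only [massForm_apply, mul_comm]

theorem stiffnessForm_comm (v w : 𝒯.smoothSpace) :
    𝒯.stiffnessForm v w = 𝒯.stiffnessForm w v := by
  simp only [stiffnessForm_apply, real_inner_comm]

theorem massForm_self (v : 𝒯.smoothSpace) : 𝒯.massForm v v = 𝒯.normSq v.1 := by
  simp only [massForm_apply, normSq, sq]

theorem stiffnessForm_self (v : 𝒯.smoothSpace) : 𝒯.stiffnessForm v v = 𝒯.gradNormSq v.1 := by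
  simp only [stiffnessForm_apply, gradNormSq, real_inner_self_eq_norm_sq]

theorem normSq_nonneg (w : 𝒯.Broken) : 0 ≤ 𝒯.normSq w :=
  Finset.sum_nonneg fun _ _ => integral_nonneg fun _ => sq_nonneg _

theorem gradNormSq_nonneg (w : 𝒯.Broken) : 0 ≤ 𝒯.gradNormSq w :=
  Finset.sum_nonneg fun _ _ => integral_nonneg fun _ => sq_nonneg _

/-- Summation over all elements visits each face once from either side, so the fluxes can be
examined face by face. -/
theorem sum_boundaryIntegral (g : Side → 𝒯.Face → Space d → ℝ) :
    ∑ k, 𝒯.boundaryIntegral k g = ∑ F ∈ 𝒯.faces,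
      ((∫ x in 𝒯.faceSet F, g .minus F x ∂μHE[d - 1]) +
        ∫ x in 𝒯.faceSet F, g .plus F x ∂μHE[d - 1]) := by
  unfold boundaryIntegral
  rw [Finset.sum_comm]
  refine Finset.sum_congr rfl fun F _ => ?_
  rw [Finset.sum_add_distrib, Finset.sum_ite_eq, Finset.sum_ite_eq]
  simp

theorem continuous_sidePoint (s : Side) (F : 𝒯.Face) : Continuous (𝒯.sidePoint s F) := by
  cases s with
  | minus => exact continuous_id
  | plus => exact continuous_id.sub continuous_const

theorem continuous_trace (s : Side) (w : 𝒯.smoothSpace) (F : 𝒯.Face) :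
    Continuous (𝒯.trace s w.1 F) :=
  (𝒯.contDiff w _).continuous.comp (𝒯.continuous_sidePoint s F)

theorem continuous_gradTrace (s : Side) (w : 𝒯.smoothSpace) (F : 𝒯.Face) :
    Continuous (𝒯.gradTrace s w.1 F) :=
  (continuous_gradient (𝒯.contDiff w _)).comp (𝒯.continuous_sidePoint s F)

variable {θ γ ζ : ℝ} (u v : 𝒯.smoothSpace)

theorem continuous_boundary_integrand (s : Side) (F : 𝒯.Face) :
    Continuous fun x => inner ℝ (𝒯.gradTrace s u.1 F x) (𝒯.normal s F) *
      (𝒯.fluxV θ ζ u.1 v.1 F x - 𝒯.trace s v.1 F x) := by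
  have h1 := fun s => 𝒯.continuous_gradTrace s u F
  have h2 := fun s => 𝒯.continuous_trace s v F
  have h3 := fun s => (h1 s).inner (continuous_const (y := 𝒯.normal s F)) (𝕜 := ℝ)
  unfold fluxV gradJump
  exact (h3 s).mul (((((h2 .plus).const_mul θ).add ((h2 .minus).const_mul (1 - θ))).sub
    (((h3 .minus).add (h3 .plus)).const_mul ζ)).sub (h2 s))

theorem continuous_boundary_integrand' (s : Side) (F : 𝒯.Face) :
    Continuous fun x => 𝒯.trace s v.1 F x *
      (inner ℝ (𝒯.fluxGradU θ γ u.1 v.1 F x) (𝒯.normal s F) : ℝ) := by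
  have h1 := fun s => 𝒯.continuous_gradTrace s u F
  have h2 := fun s => 𝒯.continuous_trace s v F
  unfold fluxGradU jump
  exact (h2 s).mul ((((((h1 .plus).const_smul (1 - θ)).add ((h1 .minus).const_smul θ))).sub
    ((((h2 .minus).smul continuous_const).add ((h2 .plus).smul continuous_const)).const_smul
      γ)).inner continuous_const)

/-- The numerical fluxes dissipate energy. -/
theorem sum_boundaryIntegral_nonpos (hγ : 0 ≤ γ) (hζ : 0 ≤ ζ) :
    (∑ k, 𝒯.boundaryIntegral k fun s F x => inner ℝ (𝒯.gradTrace s u.1 F x) (𝒯.normal s F) *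
        (𝒯.fluxV θ ζ u.1 v.1 F x - 𝒯.trace s v.1 F x)) +
      ∑ k, 𝒯.boundaryIntegral k (fun s F x => 𝒯.trace s v.1 F x *
        inner ℝ (𝒯.fluxGradU θ γ u.1 v.1 F x) (𝒯.normal s F)) ≤ 0 := by
  rw [sum_boundaryIntegral, sum_boundaryIntegral, ← Finset.sum_add_distrib]
  refine Finset.sum_nonpos fun F hF => ?_
  have i1 := fun s => 𝒯.integrableOn_faceSet hF
    (𝒯.continuous_boundary_integrand (θ := θ) (ζ := ζ) u v s F)
  have i2 := fun s => 𝒯.integrableOn_faceSet hF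
    (𝒯.continuous_boundary_integrand' (θ := θ) (γ := γ) u v s F)
  rw [← integral_add (i1 .minus) (i1 .plus), ← integral_add (i2 .minus) (i2 .plus)]
  refine (integral_add ((i1 .minus).add (i1 .plus)) ((i2 .minus).add (i2 .plus))).symm.trans_le ?_
  refine integral_nonpos fun x => ?_
  simp only [Pi.zero_apply, Pi.add_apply, fluxV, fluxGradU, gradJump, jump, normal, inner_neg_right,
    inner_sub_left, inner_add_left, real_inner_smul_left, inner_neg_left, smul_neg]
  generalize 𝒯.gradTrace .minus u.1 F x = P
  generalize 𝒯.gradTrace .plus u.1 F x = R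
  generalize 𝒯.trace .minus v.1 F x = a
  generalize 𝒯.trace .plus v.1 F x = b
  generalize outwardUnitNormal (𝒯.element F.1) (𝒯.faceSet F) = N
  -- Pointwise the terms with `θ` cancel and what remains is minus the sum of `h1` and `h2`. This
  -- uses only that the two normals are opposite, not that they have length one.
  have h1 : 0 ≤ γ * ((a - b) ^ 2 * (inner ℝ N N : ℝ)) :=
    mul_nonneg hγ (mul_nonneg (sq_nonneg _) real_inner_self_nonneg)
  have h2 := mul_nonneg hζ (sq_nonneg ((inner ℝ P N : ℝ) - inner ℝ R N))
  linarith

theorem integral_mul_source_le {f : Space d → ℝ}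
    (hf : MemLp f 2 (volume.restrict 𝒯.domain)) (v : 𝒯.smoothSpace) :
    ∑ k, ∫ x in 𝒯.element k, v.1 k x * f x ≤
      (𝒯.normSq v.1 + 𝒯.normSq (fun _ => f)) / 2 := by
  unfold normSq
  rw [← Finset.sum_add_distrib, Finset.sum_div]
  refine Finset.sum_le_sum fun k _ => ?_
  have hfk : MemLp f 2 (volume.restrict (𝒯.element k)) :=
    hf.mono_measure (Measure.restrict_mono (Set.subset_iUnion _ k) le_rfl)
  have hv2 : IntegrableOn (fun x => v.1 k x ^ 2) (𝒯.element k) :=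
    𝒯.integrableOn_element k ((𝒯.contDiff v k).continuous.pow 2)
  have hvk : MemLp (v.1 k) 2 (volume.restrict (𝒯.element k)) :=
    (memLp_two_iff_integrable_sq (𝒯.contDiff v k).continuous.aestronglyMeasurable).2 hv2
  calc ∫ x in 𝒯.element k, v.1 k x * f x
      ≤ ∫ x in 𝒯.element k, (v.1 k x ^ 2 + f x ^ 2) / 2 := by
        refine integral_mono (hvk.integrable_mul hfk) ((hv2.add hfk.integrable_sq).div_const 2)
          fun x => ?_
        have := sq_nonneg (v.1 k x - f x)
        linarith
    _ = ((∫ x in 𝒯.element k, v.1 k x ^ 2) + ∫ x in 𝒯.element k, f x ^ 2) / 2 := by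
        rw [integral_div, integral_add hv2 hfk.integrable_sq]

/-- The choice `φ = u`, `ψ = v` produces `(∇u, ∇v)` with opposite signs in the two equations. The
boundary terms are dissipative and the source is handled by Young's inequality. -/
theorem energy_le_of_DGEquations {qu qv : ℕ} (hγ : 0 ≤ γ) (hζ : 0 ≤ ζ) (du dv D : 𝒯.smoothSpace)
    {f : Space d → ℝ} (hf : MemLp f 2 (volume.restrict 𝒯.domain))
    (hu : u.1 ∈ 𝒯.polySpace qu) (hv : v.1 ∈ 𝒯.polySpace qv)
    (h : 𝒯.DGEquations θ γ ζ qu qv u.1 v.1 du.1 dv.1 D.1 f) :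
    𝒯.stiffnessForm u du + 𝒯.massForm v dv + 𝒯.massForm v D ≤
      (𝒯.massForm v v + 𝒯.normSq (fun _ => f)) / 2 := by
  have h1 : 𝒯.stiffnessForm u (du - v) = _ :=
    Finset.sum_congr rfl fun k (_ : k ∈ Finset.univ) => h.1 u.1 hu k
  have h2 := Finset.sum_congr rfl fun k (_ : k ∈ Finset.univ) => h.2 v.1 hv k
  have e : ∑ k, ∫ x in 𝒯.element k, (v.1 k x * dv.1 k x +
      inner ℝ (∇ (v.1 k) x) (∇ (u.1 k) x) + v.1 k x * D.1 k x) =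
      𝒯.massForm v dv + 𝒯.stiffnessForm v u + 𝒯.massForm v D := by
    rw [massForm_apply, stiffnessForm_apply, massForm_apply, ← Finset.sum_add_distrib,
      ← Finset.sum_add_distrib]
    refine Finset.sum_congr rfl fun k _ => ?_
    have i1 := 𝒯.integrableOn_element k (𝒯.continuous_mul v dv k)
    have i2 := 𝒯.integrableOn_element k (𝒯.continuous_inner_gradient v u k)
    have i3 := 𝒯.integrableOn_element k (𝒯.continuous_mul v D k)
    refine (integral_add (i1.add i2) i3).trans ?_
    exact congrArg (· + _) (integral_add i1 i2)
  rw [e, Finset.sum_add_distrib] at h2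
  have h3 := 𝒯.sum_boundaryIntegral_nonpos (θ := θ) u v hγ hζ
  have h4 := 𝒯.integral_mul_source_le hf v
  rw [map_sub, 𝒯.stiffnessForm_comm u v] at h1
  rw [massForm_self]
  linarith

end PeriodicMesh
-- Verification of the stability conditions for the weights of the scheme.
theorem coeffA_eq_nodeWeight {α : ℝ → ℝ} {τ σ : ℝ} {m : ℕ}
    (h : IsIntermediatePoint α τ m σ) (i : ℕ) :
    coeffA α τ σ m i = nodeWeight τ (2 * σ - 1) m i := by
  have e : α (m * τ + σ * τ) = 1 - (2 * σ - 1) := by linarith [h.2]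
  rw [coeffA, nodeWeight, e, show (1 + (2 * σ - 1)) / 2 = σ by ring,
    show 2 - (1 - (2 * σ - 1)) = 1 + (2 * σ - 1) by ring]

/-- By compactness `α` has a maximum `A < 1`, so `p = 1 - α` stays in `[1 - A, 1)` and the weight
bounds are uniform. Lipschitz continuity then turns them into `O(τ)` changes between consecutive
levels. -/
theorem exists_stableWeights {T : ℝ} (hT : 0 < T) {α : ℝ → ℝ}
    (hα : ∀ t ∈ Set.Icc 0 T, α t ∈ Set.Ioo (0 : ℝ) 1) {L : NNReal}
    (hL : LipschitzOnWith L α (Set.Icc 0 T)) :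
    ∃ K > 0, ∀ (M : ℕ) (τ : ℝ) (σ : ℕ → ℝ), 1 ≤ M → τ = T / M →
      (∀ m, 1 ≤ m → m < M → IsIntermediatePoint α τ m (σ m)) →
      ∃ k : ℕ → ℝ, StableWeights K M τ (fun m => 2 * σ m - 1)
        (fun m i => coeffA α τ (σ m) m i) k (initialScale α τ)⁻¹ := by
  obtain ⟨t₀, ht₀, hmax⟩ := isCompact_Icc.exists_isMaxOn (Set.nonempty_Icc.2 hT.le) hL.continuousOn
  set A := α t₀
  have hA : A ∈ Set.Ioo (0 : ℝ) 1 := hα t₀ ht₀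
  have hαA : ∀ t ∈ Set.Icc 0 T, α t ≤ A := fun t ht => hmax ht
  obtain ⟨C, hC, hb⟩ := exists_nodeWeight_bounds hA hT
  obtain ⟨c, hc, hΓ⟩ := exists_le_Gamma
  have hL0 : (0 : ℝ) ≤ L := L.2
  have hbA : (1 + A) / 2 ∈ Set.Ioo (0 : ℝ) 1 := ⟨by linarith [hA.1], by linarith [hA.2]⟩
  have hS0 : 0 < (1 + T) * (1 + 1 / (1 - (1 + A) / 2)) := by
    have : 0 < 1 - (1 + A) / 2 := by linarith [hbA.2]
    positivity
  set S := (1 + T) * (1 + 1 / (1 - (1 + A) / 2))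
  have hCL : 0 ≤ C * (2 * L) := by positivity
  have hTc : 0 < (1 + T) / c := by positivity
  -- One summand for each condition: size of the weights, change of `p`, change of the weights,
  -- kernel sum, and initial step.
  refine ⟨C + 2 * L + C * (2 * L) + S + (1 + T) / c, by positivity, ?_⟩
  intro M τ σ hM hτM hσ
  have hM0 : (0 : ℝ) < M := by exact_mod_cast hM
  have hτ : 0 < τ := by rw [hτM]; positivity
  have hMτ : M * τ = T := by rw [hτM]; field_simp
  have hnode : ∀ m, 1 ≤ m → m < M → m * τ + σ m * τ ∈ Set.Icc 0 T := fun m h1 h2 => by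
    have h := (hσ m h1 h2).1
    have h3 : (m : ℝ) + 1 ≤ M := by exact_mod_cast h2
    have h4 := mul_le_mul_of_nonneg_right h3 hτ.le
    have h5 : σ m * τ ≤ 1 * τ := mul_le_mul_of_nonneg_right h.2.le hτ.le
    exact ⟨add_nonneg (by positivity) (mul_nonneg (by linarith [h.1]) hτ.le), by linarith⟩
  have hpα : ∀ m, 1 ≤ m → m < M → 2 * σ m - 1 = 1 - α (m * τ + σ m * τ) := fun m h1 h2 => by
    linarith [(hσ m h1 h2).2]
  have hpIco : ∀ m, 1 ≤ m → m < M → 2 * σ m - 1 ∈ Set.Ico (1 - A) 1 := fun m h1 h2 => by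
    rw [hpα m h1 h2]
    exact ⟨by linarith [hαA _ (hnode m h1 h2)], by linarith [(hα _ (hnode m h1 h2)).1]⟩
  have hp : ∀ m, 1 ≤ m → m < M → 2 * σ m - 1 ∈ Set.Ioo (0 : ℝ) 1 := fun m h1 h2 =>
    ⟨by linarith [(hpIco m h1 h2).1, hA.2], (hpIco m h1 h2).2⟩
  have hpp : ∀ m, 1 ≤ m → m + 1 < M → |2 * σ (m + 1) - 1 - (2 * σ m - 1)| ≤ 2 * L * τ := by
    intro m h1 h2
    have h3 := hL.dist_le_mul _ (hnode m h1 (by lia)) _ (hnode (m + 1) (by lia) h2)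
    have e : 2 * σ (m + 1) - 1 - (2 * σ m - 1) =
        α (m * τ + σ m * τ) - α ((m + 1 : ℕ) * τ + σ (m + 1) * τ) := by
      rw [hpα m h1 (by lia), hpα (m + 1) (by lia) h2]; ring
    rw [e, ← Real.dist_eq]
    refine h3.trans ?_
    rw [mul_comm 2, mul_assoc]
    apply mul_le_mul_of_nonneg_left _ hL0
    have h4 := (hσ m h1 (by lia)).1
    have h5 := (hσ (m + 1) (by lia) h2).1
    rw [Real.dist_eq]
    push_cast
    -- As the `σ`'s lie in `(1/2, 1)`, consecutive nodes are less than `2 τ` apart; this is the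
    -- source of the factor `2`.
    rw [show m * τ + σ m * τ - ((m + 1) * τ + σ (m + 1) * τ) = (σ m - σ (m + 1) - 1) * τ by ring,
      abs_mul, abs_of_pos hτ]
    apply mul_le_mul_of_nonneg_right _ hτ.le
    rw [abs_le]
    constructor <;> linarith [h4.1, h4.2, h5.1, h5.2]
  have hiT : ∀ m, 1 ≤ m → m < M → ∀ i ≤ m, ((max i 1 : ℕ) : ℝ) * τ ≤ T := fun m h1 h2 i hi => by
    rw [← hMτ]
    apply mul_le_mul_of_nonneg_right _ hτ.le
    exact_mod_cast (by lia : max i 1 ≤ M)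
  have hk : ∀ i, 0 ≤ singularKernel τ ((1 + A) / 2) i := fun i => by
    unfold singularKernel; positivity
  have hτ2 : τ / 2 ∈ Set.Icc 0 T := by
    have : (1 : ℝ) ≤ M := by exact_mod_cast hM
    exact ⟨by positivity, by nlinarith⟩
  have hα2 := hα _ hτ2
  have hΓ2 := hΓ (2 - α (τ / 2)) ⟨by linarith [hα2.2], by linarith [hα2.1]⟩
  refine ⟨singularKernel τ ((1 + A) / 2), hp, ?_, ?_, ?_, ?_, ?_, ?_, hk, ?_, ?_, ?_⟩
  · intro m h1 h2
    refine (hpp m h1 h2).trans (mul_le_mul_of_nonneg_right ?_ hτ.le)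
    linarith
  · intro m h1 h2 i hi
    simp only [coeffA_eq_nodeWeight (hσ m h1 h2)]
    exact nodeWeight_nonneg hτ (hp m h1 h2) h1 hi
  · intro m h1 h2 i hi
    simp only [coeffA_eq_nodeWeight (hσ m h1 h2)]
    exact nodeWeight_succ_le hτ (hp m h1 h2) hi
  · intro m h1 h2
    simp only [coeffA_eq_nodeWeight (hσ m h1 h2)]
    exact nodeWeight_one_le hτ (hp m h1 h2) h1
  · intro m h1 h2 i hi
    simp only [coeffA_eq_nodeWeight (hσ m h1 h2)]
    refine ((hb τ hτ i (hiT m h1 h2 i hi) _ (hpIco m h1 h2) m h1).1 hi).trans ?_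
    apply mul_le_mul_of_nonneg_right _ (hk i)
    linarith
  · intro m h1 h2 i hi
    simp only [coeffA_eq_nodeWeight (hσ m h1 (by lia)),
      coeffA_eq_nodeWeight (hσ (m + 1) (by lia) h2)]
    refine ((hb τ hτ i (hiT m h1 (by lia) i hi.le) _ (hpIco (m + 1) (by lia) h2) (m + 1)
      (by lia)).2 _ (hpIco m h1 (by lia)) m (by lia) hi).trans ?_
    apply mul_le_mul_of_nonneg_right _ (hk i)
    have h3 := mul_le_mul_of_nonneg_left (hpp m h1 h2) hC.le
    have h4 : 0 ≤ (C + 2 * L + S + (1 + T) / c) * τ := by positivity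
    linarith
  · have h := sum_singularKernel_le hτ hbA (M - 1) (T := T) (by
      rw [← hMτ]
      apply mul_le_mul_of_nonneg_right _ hτ.le
      exact_mod_cast (by lia : max (M - 1) 1 ≤ M))
    rw [show M - 1 + 1 = M by lia] at h
    linarith
  · unfold initialScale
    have := hc.trans_le hΓ2
    positivity
  · have hτT : τ ≤ T := by
      have : (1 : ℝ) ≤ M := by exact_mod_cast hM
      nlinarith
    have h1 : τ ^ (1 - α (τ / 2)) ≤ 1 + T := by
      calc τ ^ (1 - α (τ / 2)) ≤ (1 + T) ^ (1 - α (τ / 2)) :=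
            Real.rpow_le_rpow hτ.le (by linarith) (by linarith [hα2.2])
        _ ≤ (1 + T) ^ (1 : ℝ) :=
            Real.rpow_le_rpow_of_exponent_le (by linarith) (by linarith [hα2.1])
        _ = 1 + T := Real.rpow_one _
    have h2 : τ = τ ^ (1 - α (τ / 2)) * τ ^ α (τ / 2) := by
      rw [← Real.rpow_add hτ, sub_add_cancel, Real.rpow_one]
    have h3 : 1 ≤ (2 : ℝ) ^ (1 - α (τ / 2)) :=
      Real.one_le_rpow (by norm_num) (by linarith [hα2.2])
    have h4 : τ * (initialScale α τ)⁻¹ =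
        τ ^ (1 - α (τ / 2)) / (2 ^ (1 - α (τ / 2)) * Real.Gamma (2 - α (τ / 2))) := by
      have h5 : (τ ^ α (τ / 2)) ≠ 0 := by positivity
      rw [initialScale, ← div_eq_mul_inv]
      nth_rewrite 1 [h2]
      rw [mul_right_comm, mul_div_mul_right _ _ h5]
    rw [h4]
    have h5 : τ ^ (1 - α (τ / 2)) / (2 ^ (1 - α (τ / 2)) * Real.Gamma (2 - α (τ / 2))) ≤
        (1 + T) / c := by
      gcongr
      nlinarith
    linarith

/-! ### From solutions of the scheme to the abstract energy inequalities. -/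

namespace PeriodicMesh

variable {d : ℕ} (𝒯 : PeriodicMesh d)

/-- `‖∇_h u‖² + ‖v‖²` as a quadratic form in `(u, v)`. -/
noncomputable def energyForm : LinearMap.BilinForm ℝ (𝒯.smoothSpace × 𝒯.smoothSpace) :=
  𝒯.stiffnessForm.compl₁₂ (LinearMap.fst ℝ _ _) (LinearMap.fst ℝ _ _) +
    𝒯.massForm.compl₁₂ (LinearMap.snd ℝ _ _) (LinearMap.snd ℝ _ _)

/-- `‖v‖²` as a quadratic form in `(u, v)`. -/
noncomputable def velocityForm : LinearMap.BilinForm ℝ (𝒯.smoothSpace × 𝒯.smoothSpace) :=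
  𝒯.massForm.compl₁₂ (LinearMap.snd ℝ _ _) (LinearMap.snd ℝ _ _)

theorem energyForm_apply (x y : 𝒯.smoothSpace × 𝒯.smoothSpace) :
    𝒯.energyForm x y = 𝒯.stiffnessForm x.1 y.1 + 𝒯.massForm x.2 y.2 := rfl

theorem velocityForm_apply (x y : 𝒯.smoothSpace × 𝒯.smoothSpace) :
    𝒯.velocityForm x y = 𝒯.massForm x.2 y.2 := rfl

theorem average_mem_polySpace {s : ℕ} {w : ℕ → 𝒯.Broken} {m : ℕ} (σ : ℝ)
    (h : w m ∈ 𝒯.polySpace s) (h' : w (m + 1) ∈ 𝒯.polySpace s) :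
    average σ w m ∈ 𝒯.polySpace s :=
  𝒯.add_mem_polySpace (𝒯.smul_mem_polySpace _ h') (𝒯.smul_mem_polySpace _ h)

end PeriodicMesh

/-- Solutions of the fully discrete scheme satisfy the energy inequalities. -/
theorem IsDGSolution.exists_schemeInequalities {d : ℕ} {𝒯 : PeriodicMesh d} {qu qv : ℕ}
    {θ γ ζ : ℝ} {α : ℝ → ℝ} {σ : ℕ → ℝ} {f : ℝ → Space d → ℝ} {M : ℕ} {τ : ℝ}
    {u v : ℕ → 𝒯.Broken} (h : IsDGSolution 𝒯 qu qv θ γ ζ α σ f M τ u v) (hM : 1 ≤ M)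
    (hγ : 0 ≤ γ) (hζ : 0 ≤ ζ) (hf0 : MemLp (f (τ / 2)) 2 (volume.restrict 𝒯.domain))
    (hf : ∀ m, 1 ≤ m → m < M → MemLp (f (m * τ + σ m * τ)) 2 (volume.restrict 𝒯.domain)) :
    ∃ w : ℕ → 𝒯.smoothSpace × 𝒯.smoothSpace,
      (∀ m ≤ M, ((w m).1 : 𝒯.Broken) = u m ∧ ((w m).2 : 𝒯.Broken) = v m) ∧
      SchemeInequalities 𝒯.energyForm 𝒯.velocityForm M τ (fun m => 2 * σ m - 1)
        (fun m i => coeffA α τ (σ m) m i) (initialScale α τ)⁻¹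
        (fun m => if m = 0 then 𝒯.normSq (fun _ => f (τ / 2))
          else 𝒯.normSq (fun _ => f (m * τ + σ m * τ))) w := by
  classical
  -- Regularity is known only up to level `M`; beyond it the sequences are continued by zero, which
  -- the inequalities never use.
  let U : ℕ → 𝒯.smoothSpace := fun m =>
    if hm : m ≤ M then ⟨u m, 𝒯.mem_smoothSpace_of_mem_polySpace (h.u_mem m hm)⟩ else 0
  let V : ℕ → 𝒯.smoothSpace := fun m =>
    if hm : m ≤ M then ⟨v m, 𝒯.mem_smoothSpace_of_mem_polySpace (h.v_mem m hm)⟩ else 0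
  have hU : ∀ m ≤ M, (U m : 𝒯.Broken) = u m := fun m hm => by simp [U, hm]
  have hV : ∀ m ≤ M, (V m : 𝒯.Broken) = v m := fun m hm => by simp [V, hm]
  refine ⟨fun m => (U m, V m), fun m hm => ⟨hU m hm, hV m hm⟩, ?_, ?_⟩
  · have hu : ((average (1 / 2) U 0 : 𝒯.smoothSpace) : 𝒯.Broken) = average (1 / 2) u 0 := by
      simp [average, hU 0 (by lia), hU 1 hM]
    have hv : ((average (1 / 2) V 0 : 𝒯.smoothSpace) : 𝒯.Broken) = average (1 / 2) v 0 := by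
      simp [average, hV 0 (by lia), hV 1 hM]
    have key := 𝒯.energy_le_of_DGEquations (θ := θ) (qu := qu) (qv := qv)
      (average (1 / 2) U 0) (average (1 / 2) V 0) hγ hζ
      (τ⁻¹ • (U 1 - U 0)) (τ⁻¹ • (V 1 - V 0)) ((initialScale α τ)⁻¹ • (V 1 - V 0)) hf0
      (by rw [hu]; exact 𝒯.average_mem_polySpace _ (h.u_mem _ (by lia)) (h.u_mem _ hM))
      (by rw [hv]; exact 𝒯.average_mem_polySpace _ (h.v_mem _ (by lia)) (h.v_mem _ hM))
      (by
        rw [hu, hv]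
        simpa [hU 0 (by lia), hU 1 hM, hV 0 (by lia), hV 1 hM] using h.initial_step)
    exact key
  · intro m h1 h2
    have hm : m - 1 ≤ M := by lia
    have hu : ((average (σ m) U m : 𝒯.smoothSpace) : 𝒯.Broken) = average (σ m) u m := by
      simp [average, hU m h2.le, hU (m + 1) h2]
    have hv : ((average (σ m) V m : 𝒯.smoothSpace) : 𝒯.Broken) = average (σ m) v m := by
      simp [average, hV m h2.le, hV (m + 1) h2]
    have hdu : ((timeDiff τ (σ m) U m : 𝒯.smoothSpace) : 𝒯.Broken) = timeDiff τ (σ m) u m := by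
      simp [timeDiff, hU m h2.le, hU (m + 1) h2, hU (m - 1) hm]
    have hdv : ((timeDiff τ (σ m) V m : 𝒯.smoothSpace) : 𝒯.Broken) = timeDiff τ (σ m) v m := by
      simp [timeDiff, hV m h2.le, hV (m + 1) h2, hV (m - 1) hm]
    have hD : ((∑ i ∈ Finset.range (m + 1), coeffA α τ (σ m) m (m - i) • (V (i + 1) - V i) :
        𝒯.smoothSpace) : 𝒯.Broken) =
        ∑ i ∈ Finset.range (m + 1), coeffA α τ (σ m) m (m - i) • (v (i + 1) - v i) := by
      rw [Submodule.coe_sum]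
      refine Finset.sum_congr rfl fun i hi => ?_
      have hi := Finset.mem_range.1 hi
      rw [Submodule.coe_smul, Submodule.coe_sub, hV i (by lia), hV (i + 1) (by lia)]
    have key := 𝒯.energy_le_of_DGEquations (θ := θ) (qu := qu) (qv := qv)
      (average (σ m) U m) (average (σ m) V m) hγ hζ
      (timeDiff τ (σ m) U m) (timeDiff τ (σ m) V m)
      (∑ i ∈ Finset.range (m + 1), coeffA α τ (σ m) m (m - i) • (V (i + 1) - V i)) (hf m h1 h2)
      (by rw [hu]; exact 𝒯.average_mem_polySpace _ (h.u_mem _ h2.le) (h.u_mem _ h2))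
      (by rw [hv]; exact 𝒯.average_mem_polySpace _ (h.v_mem _ h2.le) (h.v_mem _ h2))
      (by rw [hu, hv, hdu, hdv, hD]; exact h.general_step m h1 h2)
    rw [show (1 + (2 * σ m - 1)) / 2 = σ m by ring, if_neg (by lia)]
    have e : (∑ i ∈ Finset.range (m + 1), coeffA α τ (σ m) m (m - i) •
        ((U (i + 1), V (i + 1)) - (U i, V i))).2 =
        ∑ i ∈ Finset.range (m + 1), coeffA α τ (σ m) m (m - i) • (V (i + 1) - V i) := by
      rw [Prod.snd_sum]
      rfl
    simp only [PeriodicMesh.energyForm_apply, PeriodicMesh.velocityForm_apply, e]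
    exact key

end EnergyDG

/-! ### Conclusion: the weights and the energy inequalities are fed into the abstract stability
estimate. -/

theorem mainTheorem1 (T : ℝ) (hT : 0 < T) (α : ℝ → ℝ)
    (hα : ∀ t ∈ Set.Icc 0 T, α t ∈ Set.Ioo (0 : ℝ) 1)
    (hLip : ∃ L : NNReal, LipschitzOnWith L α (Set.Icc 0 T)) :
    ∃ τ₀ > 0, ∃ C > 0, ∀ (d : ℕ), 1 ≤ d →
      ∀ (𝒯 : EnergyDG.PeriodicMesh d) (qu qv : ℕ) (θ γ ζ : ℝ), 0 ≤ γ → 0 ≤ ζ →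
      ∀ (M : ℕ) (τ : ℝ), 1 ≤ M → τ = T / M → τ ≤ τ₀ →
      ∀ (σ : ℕ → ℝ), (∀ m, 1 ≤ m → m < M → EnergyDG.IsIntermediatePoint α τ m (σ m)) →
      ∀ (f : ℝ → EnergyDG.Space d → ℝ),
        (∀ t ∈ Set.Ioc 0 T, MemLp (f t) 2 (volume.restrict 𝒯.domain)) →
      ∀ (u v : ℕ → 𝒯.Broken), EnergyDG.IsDGSolution 𝒯 qu qv θ γ ζ α σ f M τ u v →
      ∀ m ≤ M,
        𝒯.gradNormSq (u m) + 𝒯.normSq (v m) ≤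
          C * (𝒯.gradNormSq (u 0) + 𝒯.normSq (v 0) +
            τ * 𝒯.normSq (fun _ => f (τ / 2)) +
            τ * ∑ i ∈ Finset.Ico 1 m, 𝒯.normSq (fun _ => f (i * τ + σ i * τ))) := by
  obtain ⟨L, hL⟩ := hLip
  obtain ⟨K, hK, hweights⟩ := EnergyDG.exists_stableWeights hT hα hL
  obtain ⟨τ₀, hτ₀, C, hC, hstab⟩ := EnergyDG.exists_stability_constant hT hK
  refine ⟨τ₀, hτ₀, C, hC, ?_⟩
  intro d _ 𝒯 qu qv θ γ ζ hγ hζ M τ hM hτM hττ₀ σ hσ f hf u v h n hn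
  have hM1 : (1 : ℝ) ≤ M := by exact_mod_cast hM
  have hτ : 0 < τ := by rw [hτM]; positivity
  have hMτ : M * τ = T := by rw [hτM]; field_simp
  have hf0 := hf (τ / 2) ⟨by positivity, by nlinarith⟩
  have hfm : ∀ m, 1 ≤ m → m < M →
      MemLp (f (m * τ + σ m * τ)) 2 (volume.restrict 𝒯.domain) := fun m h1 h2 => by
    have h3 := (hσ m h1 h2).1
    have h4 : (m : ℝ) + 1 ≤ M := by exact_mod_cast h2
    have h5 := mul_le_mul_of_nonneg_right h4 hτ.le
    have h6 : σ m * τ ≤ 1 * τ := mul_le_mul_of_nonneg_right h3.2.le hτ.le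
    exact hf _ ⟨add_pos_of_nonneg_of_pos (by positivity) (mul_pos (by linarith [h3.1]) hτ),
      by linarith⟩
  obtain ⟨k, hk⟩ := hweights M τ σ hM hτM hσ
  obtain ⟨w, hw, hineq⟩ := h.exists_schemeInequalities hM hγ hζ hf0 hfm
  have hnorm : ∀ m ≤ M, 𝒯.energyForm (w m) (w m) = 𝒯.gradNormSq (u m) + 𝒯.normSq (v m) :=
    fun m hm => by
      rw [𝒯.energyForm_apply, 𝒯.stiffnessForm_self, 𝒯.massForm_self, (hw m hm).1, (hw m hm).2]
  have hmass : ∀ x, 0 ≤ 𝒯.velocityForm x x := fun x => by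
    rw [𝒯.velocityForm_apply, 𝒯.massForm_self]; exact 𝒯.normSq_nonneg _
  have key := hstab 𝒯.energyForm 𝒯.velocityForm
    (fun x y => by rw [𝒯.velocityForm_apply, 𝒯.velocityForm_apply, 𝒯.massForm_comm])
    (fun x y => by
      rw [𝒯.energyForm_apply, 𝒯.energyForm_apply, 𝒯.massForm_comm, 𝒯.stiffnessForm_comm])
    hmass
    (fun x => by
      rw [𝒯.velocityForm_apply, 𝒯.energyForm_apply, 𝒯.stiffnessForm_self]
      linarith [𝒯.gradNormSq_nonneg x.1.1])
    M τ hτ hMτ.le hττ₀ _ _ _ _ hk _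
    (fun m => by
      split_ifs <;> exact 𝒯.normSq_nonneg _)
    w hineq n hn
  rw [hnorm n hn, hnorm 0 (Nat.zero_le _), if_pos rfl] at key
  refine key.trans (le_of_eq ?_)
  congr 3
  refine Finset.sum_congr rfl fun i hi => ?_
  rw [if_neg (by have := (Finset.mem_Ico.1 hi).1; lia)]
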